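/- Let $N\ge 1$, let $\tilde K\in\mathbb R^{N^2\times N^2}$ and $\tilde f\in\mathbb R^{N^2}$, let $\alpha,\beta,\sigma>0$, and let $\varphi:\mathbb R\to\mathbb R$ be coercive, i.e. $\varphi(t)\to+\infty$ as $|t|\to\infty$. Let $D\in\mathbb R^{(N-1)\times N}$ be the matrix with $D_{i,i}=1$, $D_{i,i+1}=-1$ and all other entries $0$, and put $$\mathcal T=\begin{pmatrix} I_N\otimes D&0\\0&D\otimes I_N\end{pmatrix}\in\mathbb R^{2N(N-1)\times 2N^2},\quad K=\begin{pmatrix}\tilde K&0\\ \beta I&-\beta I\end{pmatrix},\quad K_0=\begin{pmatrix}\tilde K&0\\ I&-I\end{pmatrix},\quad f=\begin{pmatrix}\tilde f\\0\end{pmatrix}.$$ Assume $\mathrm{Null}(K_0)\cap\mathrm{Null}(\mathcal T)=\{0\}$. Let $\nu=\lambda_{\min}(K^*K+\mathcal T^*\mathcal T)$, let $\|K\|_2$ be the spectral norm of $K$, and let $\theta=1/\bigl(2\sin\frac{\pi}{2N}\bigr)$. For $u\in\mathbb R^{2N^2}$ and $v,p\in\mathbb R^{2N(N-1)}$ let $\|v\|_\varphi=\sum_e\varphi(v_e)$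 and $$\mathcal L_\delta^\varphi(u,v,p)=\tfrac12\|Ku-f\|^2+\sigma\|v\|_\varphi-\langle p,\mathcal Tu-v\rangle+\tfrac\delta2\|\mathcal Tu-v\|^2 .$$ Assume that $$\delta>\max\Bigl\{1,\ \frac{6\theta^2\|K\|_2^4}{\nu}+\frac{7\alpha^2\theta^2\|K\|_2^4}{\nu},\ \theta^2\|K\|_2^4\Bigr\}$$ and that the function $$F(u,v,p,x)=\mathcal L_\delta^\varphi(u,v,p)+\frac{7\alpha^2\theta^2\|K\|_2^4}{2\delta}\|u-x\|^2$$ is a Kurdyka–Łojasiewicz function. That is, $F$ is lower semicontinuous, and at each point $\hat w$ where the limiting subdifferential $\partial F(\hat w)$ is nonempty there are $\eta\in(0,\infty]$, a neighbourhood $U$ of $\hat w$ and a continuous concave $\rho:[0,\eta)\to[0,\infty)$, $C^1$ on $(0,\eta)$, with $\rho(0)=0$ and $\rho'>0$ on $(0,\eta)$, such that $\rho'(F(w)-F(\hat w))\,\mathrm{dist}(0,\partial F(w))\ge1$ for all $w\in U$ with $F(\hat w)<F(w)<F(\hat w)+\eta$ (where $\mathrm{dist}(0,\emptyset)=\infty$).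 Let $(u^k,v^k,p^k)_{k\ge0}$ be any sequence generated by the inertial nonconvex ADMM: $(u^0,v^0,p^0)=(u^1,v^1,p^1)$ is arbitrary and, for $k\ge1$, with $\hat p^k=p^k+\alpha(p^k-p^{k-1})$, $$v^{k+1}\in\arg\min_v\Bigl\{\tfrac\sigma\delta\|v\|_\varphi+\tfrac12\bigl\|\mathcal Tu^k-\tfrac{\hat p^k}{\delta}-v\bigr\|^2\Bigr\},$$ $$u^{k+1}=(K^*K+\delta\mathcal T^*\mathcal T)^{-1}\bigl(K^*f+\delta\mathcal T^*v^{k+1}+\mathcal T^*\hat p^k\bigr),$$ $$p^{k+1}=\hat p^k-\delta(\mathcal Tu^{k+1}-v^{k+1}).$$ Then the whole sequence $(u^k,v^k,p^k)$ converges to a point $(u^*,v^*,p^*)$ that is a critical point of $\mathcal L_\delta^\varphi$, i.e. $0\in\partial\mathcal L_\delta^\varphi(u^*,v^*,p^*)$, where $\partial$ is the limiting subdifferential. -/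

import Mathlib

open scoped Kronecker RealInnerProductSpace Topology

noncomputable section

/-! ### Variational analysis -/

section Variational

variable {E : Type*} [NormedAddCommGroup E] [InnerProductSpace ℝ E]

/-- Fréchet subdifferential: `g` such that
`liminf_{y → x, y ≠ x} (J y - J x - ⟪g, y - x⟫) / ‖y - x‖ ≥ 0`. -/
def frechetSubdiff (J : E → ℝ) (x : E) : Set E :=
  {g | ∀ ε : ℝ, 0 < ε → ∀ᶠ y in 𝓝 x, -(ε * ‖y - x‖) ≤ J y - J x - ⟪g, y - x⟫}

/-- Limiting (Mordukhovich) subdifferential. -/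
def limitSubdiff (J : E → ℝ) (x : E) : Set E :=
  {g | ∃ (xs gs : ℕ → E),
      Filter.Tendsto xs Filter.atTop (𝓝 x) ∧
      Filter.Tendsto (fun k => J (xs k)) Filter.atTop (𝓝 (J x)) ∧
      Filter.Tendsto gs Filter.atTop (𝓝 g) ∧
      ∀ k, gs k ∈ frechetSubdiff J (xs k)}

/-- (Limiting) critical points. -/
def IsCriticalPoint (J : E → ℝ) (x : E) : Prop := (0 : E) ∈ limitSubdiff J x

/-- The Kurdyka–Łojasiewicz property of `J` at `x₀`. A radius `η = ∞` may always be replaced by a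
finite one, so `η` is real here. The distance to the empty set is `∞`, hence the use of the
extended distance. -/
def HasKLAt (J : E → ℝ) (x₀ : E) : Prop :=
  ∃ η : ℝ, 0 < η ∧ ∃ U ∈ 𝓝 x₀, ∃ ρ : ℝ → ℝ,
    ContinuousOn ρ (Set.Ico 0 η) ∧
    ConcaveOn ℝ (Set.Ico 0 η) ρ ∧
    (∀ s ∈ Set.Ico 0 η, 0 ≤ ρ s) ∧
    ρ 0 = 0 ∧
    ContDiffOn ℝ 1 ρ (Set.Ioo 0 η) ∧
    (∀ s ∈ Set.Ioo 0 η, 0 < deriv ρ s) ∧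
    ∀ x ∈ U, J x₀ < J x → J x < J x₀ + η →
      1 ≤ ENNReal.ofReal (deriv ρ (J x - J x₀)) * Metric.infEDist (0 : E) (limitSubdiff J x)

/-- KL functions: lower semicontinuous functions with the KL property at every point of the domain
of the subdifferential (a real-valued function is automatically proper). -/
def IsKLFunction (J : E → ℝ) : Prop :=
  LowerSemicontinuous J ∧ ∀ x, (limitSubdiff J x).Nonempty → HasKLAt J x

/-- The (set-valued) proximal map `argmin_y J y + ½ ‖x - y‖²`. -/
def proxSet (J : E → ℝ) (x : E) : Set E :=
  {y | ∀ z, J y + 1 / 2 * ‖x - y‖ ^ 2 ≤ J z + 1 / 2 * ‖x - z‖ ^ 2}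

end Variational

/-! ### Matrices acting on Euclidean spaces -/

/-- Spectral norm `‖A‖₂ = max_{‖x‖ = 1} ‖A x‖`. -/
def specNorm {m n : Type*} [Fintype m] [Fintype n] [DecidableEq n] (A : Matrix m n ℝ) : ℝ :=
  ‖(Matrix.toEuclideanLin A).toContinuousLinearMap‖

/-- Least (real) eigenvalue of a square matrix. -/
def lambdaMin {n : Type*} [Fintype n] [DecidableEq n] (A : Matrix n n ℝ) : ℝ :=
  sInf {μ : ℝ | Module.End.HasEigenvalue
    (Matrix.toEuclideanLin A : Module.End ℝ (EuclideanSpace ℝ n)) μ}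

/-! ### The deblurring model -/

/-- Pixels, indexed as (column, row): an image is vectorized column by column. -/
abbrev Pix (N : ℕ) : Type := Fin N × Fin N

/-- Index set of the `2N(N-1)` differences. -/
abbrev Edge (N : ℕ) : Type := (Fin N × Fin (N - 1)) ⊕ (Fin (N - 1) × Fin N)

/-- The space of `u = (u₁, u₂)`. -/
abbrev USpace (N : ℕ) : Type := EuclideanSpace ℝ (Pix N ⊕ Pix N)

/-- The space of `v` and of `p`. -/
abbrev VSpace (N : ℕ) : Type := EuclideanSpace ℝ (Edge N)

/-- The space of triples `(u, v, p)`, with its Euclidean structure. -/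
abbrev ZSpace (N : ℕ) : Type := WithLp 2 (USpace N × WithLp 2 (VSpace N × VSpace N))

/-- The space of quadruples `((u, v, p), x)`, with its Euclidean structure. -/
abbrev WSpace (N : ℕ) : Type := WithLp 2 (ZSpace N × USpace N)

/-- The triple `(u, v, p)`. -/
def triple {N : ℕ} (u : USpace N) (v p : VSpace N) : ZSpace N :=
  WithLp.toLp 2 (u, WithLp.toLp 2 (v, p))

/-- The `(N-1) × N` banded matrix `D` with rows `(…, 1, -1, …)`. -/
def diffMatrix (N : ℕ) : Matrix (Fin (N - 1)) (Fin N) ℝ :=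
  fun i j => if (j : ℕ) = (i : ℕ) then 1 else if (j : ℕ) = (i : ℕ) + 1 then -1 else 0

/-- `𝒯 = diag(I_N ⊗ D, D ⊗ I_N)`. -/
def gradMatrix (N : ℕ) : Matrix (Edge N) (Pix N ⊕ Pix N) ℝ :=
  Matrix.fromBlocks
    ((1 : Matrix (Fin N) (Fin N) ℝ) ⊗ₖ diffMatrix N) 0
    0 (diffMatrix N ⊗ₖ (1 : Matrix (Fin N) (Fin N) ℝ))

/-- `K = [[K̃, 0], [β I, -β I]]`. -/
def blurMatrix {N : ℕ} (Kt : Matrix (Pix N) (Pix N) ℝ) (β : ℝ) :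
    Matrix (Pix N ⊕ Pix N) (Pix N ⊕ Pix N) ℝ :=
  Matrix.fromBlocks Kt 0 (β • 1) (-(β • 1))

/-- `f = (f̃, 0)`. -/
def dataVec {N : ℕ} (ft : EuclideanSpace ℝ (Pix N)) : USpace N :=
  WithLp.toLp 2 (Sum.elim (fun i => ft i) (fun _ => 0))

/-- `‖v‖_φ = ∑ φ(v_{ij})`. -/
def phiNorm {N : ℕ} (φ : ℝ → ℝ) (v : VSpace N) : ℝ := ∑ e, φ (v e)

/-- The augmented Lagrangian
`½‖K u - f‖² + σ‖v‖_φ - ⟨p, 𝒯 u - v⟩ + (δ/2)‖𝒯 u - v‖²`. -/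
def augLagrangian {N : ℕ} (Kt : Matrix (Pix N) (Pix N) ℝ) (ft : EuclideanSpace ℝ (Pix N))
    (β σ δ : ℝ) (φ : ℝ → ℝ) (z : ZSpace N) : ℝ :=
  let u : USpace N := z.fst
  let v : VSpace N := z.snd.fst
  let p : VSpace N := z.snd.snd
  let r : VSpace N := Matrix.toEuclideanLin (gradMatrix N) u - v
  1 / 2 * ‖Matrix.toEuclideanLin (blurMatrix Kt β) u - dataVec ft‖ ^ 2 + σ * phiNorm φ v
    - ⟪p, r⟫ + δ / 2 * ‖r‖ ^ 2

/-- `θ = 1 / (2 sin(π / (2N)))`. -/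
def thetaConst (N : ℕ) : ℝ := 1 / (2 * Real.sin (Real.pi / (2 * (N : ℝ))))

/-- `ν = λ_min(K* K + 𝒯* 𝒯)`. -/
def nuConst {N : ℕ} (Kt : Matrix (Pix N) (Pix N) ℝ) (β : ℝ) : ℝ :=
  lambdaMin ((blurMatrix Kt β).transpose * blurMatrix Kt β
    + (gradMatrix N).transpose * gradMatrix N)

/-- The auxiliary function `F(u,v,p,x) = L(u,v,p) + (7 α² θ² ‖K‖⁴ / (2δ)) ‖u - x‖²`. -/
def auxFun {N : ℕ} (Kt : Matrix (Pix N) (Pix N) ℝ) (ft : EuclideanSpace ℝ (Pix N))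
    (β σ δ α : ℝ) (φ : ℝ → ℝ) (w : WSpace N) : ℝ :=
  augLagrangian Kt ft β σ δ φ w.fst
    + 7 * α ^ 2 * thetaConst N ^ 2 * specNorm (blurMatrix Kt β) ^ 4 / (2 * δ)
      * ‖w.fst.fst - w.snd‖ ^ 2

/-- The extrapolated point `x^{k+1} + α (x^{k+1} - x^k)`, that is `x̂` with index `k + 1`. -/
def extrap {E : Type*} [AddCommGroup E] [Module ℝ E] (α : ℝ) (x : ℕ → E) (k : ℕ) : E :=
  x (k + 1) + α • (x (k + 1) - x k)

/-- `(u, v, p)` is a sequence generated by the inertial nonconvex ADMM. The initial point is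
arbitrary; `v` is updated by any selection of the (set-valued) proximal map. The step from `k + 1`
to `k + 2` (`k ≥ 0`) is spelled out. -/
structure IsIADMM {N : ℕ} (Kt : Matrix (Pix N) (Pix N) ℝ) (ft : EuclideanSpace ℝ (Pix N))
    (β σ δ α : ℝ) (φ : ℝ → ℝ) (u : ℕ → USpace N) (v p : ℕ → VSpace N) : Prop where
  init_u : u 0 = u 1
  init_v : v 0 = v 1
  init_p : p 0 = p 1
  step_v : ∀ k, v (k + 2) ∈ proxSet (fun y => σ / δ * phiNorm φ y)
    (Matrix.toEuclideanLin (gradMatrix N) (u (k + 1)) - (1 / δ) • extrap α p k)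
  step_u : ∀ k, u (k + 2) =
    Matrix.toEuclideanLin
      (((blurMatrix Kt β).transpose * blurMatrix Kt β
        + δ • ((gradMatrix N).transpose * gradMatrix N))⁻¹)
      (Matrix.toEuclideanLin (blurMatrix Kt β).transpose (dataVec ft)
        + δ • Matrix.toEuclideanLin (gradMatrix N).transpose (v (k + 2))
        + Matrix.toEuclideanLin (gradMatrix N).transpose (extrap α p k))
  step_p : ∀ k, p (k + 2) =
    extrap α p k - δ • (Matrix.toEuclideanLin (gradMatrix N) (u (k + 2)) - v (k + 2))

end

noncomputable section

/-! ### Desingularizing functions -/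

/-- `ρ` is nonnegative on `[0, η)` and has the nonnegative supergradient `d a` at each
`a ∈ (0, η)`. -/
structure IsDesingularizer (η : ℝ) (ρ d : ℝ → ℝ) : Prop where
  pos : 0 < η
  nonneg : ∀ s ∈ Set.Ico 0 η, 0 ≤ ρ s
  tangent : ∀ a ∈ Set.Ioo 0 η, ∀ b ∈ Set.Ico 0 η, ρ b ≤ ρ a + d a * (b - a)
  slope_nonneg : ∀ a ∈ Set.Ioo 0 η, 0 ≤ d a

namespace IsDesingularizer

variable {η η₁ η₂ : ℝ} {ρ d ρ₁ d₁ ρ₂ d₂ : ℝ → ℝ}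

theorem antitone (h : IsDesingularizer η ρ d) {a b : ℝ} (ha : 0 < a) (hab : a ≤ b) (hb : b < η) :
    d b ≤ d a := by
  rcases hab.eq_or_lt with rfl | hab
  · rfl
  · have h1 := h.tangent a ⟨ha, hab.trans hb⟩ b ⟨by linarith, hb⟩
    have h2 := h.tangent b ⟨by linarith, hb⟩ a ⟨ha.le, by linarith⟩
    have h3 : 0 ≤ (d a - d b) * (b - a) := by nlinarith
    have := nonneg_of_mul_nonneg_left h3 (by linarith)
    linarith

theorem mono (h : IsDesingularizer η₁ ρ d) (hη : 0 < η₂) (hle : η₂ ≤ η₁) :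
    IsDesingularizer η₂ ρ d where
  pos := hη
  nonneg s hs := h.nonneg s ⟨hs.1, hs.2.trans_le hle⟩
  tangent a ha b hb := h.tangent a ⟨ha.1, ha.2.trans_le hle⟩ b ⟨hb.1, hb.2.trans_le hle⟩
  slope_nonneg a ha := h.slope_nonneg a ⟨ha.1, ha.2.trans_le hle⟩

theorem add (h₁ : IsDesingularizer η ρ₁ d₁) (h₂ : IsDesingularizer η ρ₂ d₂) :
    IsDesingularizer η (fun s => ρ₁ s + ρ₂ s) (fun s => d₁ s + d₂ s) where
  pos := h₁.pos
  nonneg s hs := add_nonneg (h₁.nonneg s hs) (h₂.nonneg s hs)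
  tangent a ha b hb := by
    have := h₁.tangent a ha b hb
    have := h₂.tangent a ha b hb
    simp only [add_mul]
    linarith
  slope_nonneg a ha := add_nonneg (h₁.slope_nonneg a ha) (h₂.slope_nonneg a ha)

theorem comp_half (h : IsDesingularizer η ρ d) :
    IsDesingularizer η (fun s => 2 * ρ (s / 2)) (fun s => d (s / 2)) where
  pos := h.pos
  nonneg s hs := by
    have := h.nonneg (s / 2) ⟨by linarith [hs.1], by linarith [hs.1, hs.2]⟩
    positivity
  tangent a ha b hb := by
    have := h.tangent (a / 2) ⟨by linarith [ha.1], by linarith [ha.1, ha.2]⟩ (b / 2)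
      ⟨by linarith [hb.1], by linarith [hb.1, hb.2]⟩
    have e : d (a / 2) * (b / 2 - a / 2) = d (a / 2) * (b - a) / 2 := by ring
    rw [e] at this
    linarith
  slope_nonneg a ha := h.slope_nonneg _ ⟨by linarith [ha.1], by linarith [ha.1, ha.2]⟩

theorem const_one (hη : 0 < η) : IsDesingularizer η (fun _ => 1) (fun _ => 0) where
  pos := hη
  nonneg _ _ := zero_le_one
  tangent _ _ _ _ := by simp
  slope_nonneg _ _ := le_rfl

theorem sqrt (hη : 0 < η) :
    IsDesingularizer η (fun s => 2 * Real.sqrt s) (fun s => (Real.sqrt s)⁻¹) where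
  pos := hη
  nonneg _ _ := by positivity
  tangent a ha b hb := by
    have h1 : 0 < Real.sqrt a := Real.sqrt_pos.2 ha.1
    have h2 := Real.sq_sqrt ha.1.le
    have h3 := Real.sq_sqrt hb.1
    have e : 2 * √a + (√a)⁻¹ * (b - a) - 2 * √b = (√a)⁻¹ * (√a - √b) ^ 2 := by
      rw [← h2, ← h3]
      field_simp
      rw [Real.sqrt_sq h1.le, Real.sqrt_sq (Real.sqrt_nonneg _)]
      ring
    have : 0 ≤ (√a)⁻¹ * (√a - √b) ^ 2 := by positivity
    linarith
  slope_nonneg _ _ := by positivity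

end IsDesingularizer

theorem ConcaveOn.isDesingularizer {η : ℝ} {ρ : ℝ → ℝ} (hη : 0 < η)
    (hconc : ConcaveOn ℝ (Set.Ico 0 η) ρ) (hnn : ∀ s ∈ Set.Ico 0 η, 0 ≤ ρ s)
    (hdiff : ContDiffOn ℝ 1 ρ (Set.Ioo 0 η)) (hpos : ∀ s ∈ Set.Ioo 0 η, 0 < deriv ρ s) :
    IsDesingularizer η ρ (deriv ρ) where
  pos := hη
  nonneg := hnn
  slope_nonneg s hs := (hpos s hs).le
  tangent a ha b hb := by
    have hda : DifferentiableAt ℝ ρ a :=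
      (hdiff.differentiableOn (by norm_num)).differentiableAt (isOpen_Ioo.mem_nhds ha)
    have ha' : a ∈ Set.Ico 0 η := ⟨ha.1.le, ha.2⟩
    rcases lt_trichotomy a b with h | h | h
    · have := hconc.slope_le_deriv ha' hb h hda
      rw [slope_def_field, div_le_iff₀ (by linarith)] at this
      linarith
    · simp [h]
    · have := hconc.deriv_le_slope hb ha' h hda
      rw [slope_def_field, le_div_iff₀ (by linarith)] at this
      linarith

/-! ### Finite length of sequences with sufficient decrease -/

theorem summable_of_desingularized_descent {η ε M ℓ : ℝ} {ρ d : ℝ → ℝ} {t E : ℕ → ℝ}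
    (hd : IsDesingularizer η ρ d) (hε : 0 < ε) (hM : 0 ≤ M) (ht : ∀ n, 0 ≤ t n)
    (hE : ∀ n, ℓ ≤ E n) (hdesc : ∀ n, ε * t (n + 2) ^ 2 ≤ E n - E (n + 1))
    (hη : ∀ᶠ n in Filter.atTop, E n < ℓ + η)
    (hkl : ∀ᶠ n in Filter.atTop, ℓ < E n → 1 ≤ d (E n - ℓ) * (M * (t (n + 1) + t n))) :
    Summable t := by
  obtain ⟨n₀, hn₀⟩ := Filter.eventually_atTop.1 (hη.and hkl)
  set c : ℝ := M / ε with hc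
  have hc0 : 0 ≤ c := by positivity
  have hmem : ∀ n, n₀ ≤ n → E n - ℓ ∈ Set.Ico 0 η := fun n hn =>
    ⟨by linarith [hE n], by linarith [(hn₀ n hn).1]⟩
  have key : ∀ n, n₀ ≤ n →
      t (n + 2) ≤ 1 / 4 * (t (n + 1) + t n) + c * (ρ (E n - ℓ) - ρ (E (n + 1) - ℓ)) := by
    intro n hn
    have h1 := hdesc n
    have hτ : 0 ≤ t (n + 1) + t n := add_nonneg (ht _) (ht _)
    rcases (hE n).eq_or_lt with h | h
    · have h2 := hE (n + 1)
      have h3 : 0 ≤ ε * t (n + 2) ^ 2 := by positivity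
      have h4 : E (n + 1) = E n := by linarith
      have h5 : t (n + 2) = 0 := by
        have : ε * t (n + 2) ^ 2 = 0 := by linarith
        simpa [hε.ne'] using this
      rw [h4, h5]
      nlinarith
    · have h2 := (hn₀ n hn).2 h
      set τ := t (n + 1) + t n with hτdef
      have hm := hmem n hn
      have h3 := hd.tangent (E n - ℓ) ⟨by linarith, hm.2⟩ _ (hmem (n + 1) (by omega))
      set D := d (E n - ℓ) with hD
      have hD0 : 0 ≤ D := hd.slope_nonneg _ ⟨by linarith, hm.2⟩
      set δ := ρ (E n - ℓ) - ρ (E (n + 1) - ℓ) with hδ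
      have h4 : D * (ε * t (n + 2) ^ 2) ≤ δ := by
        have : D * (ε * t (n + 2) ^ 2) ≤ D * (E n - E (n + 1)) :=
          mul_le_mul_of_nonneg_left h1 hD0
        have e : D * (E (n + 1) - ℓ - (E n - ℓ)) = -(D * (E n - E (n + 1))) := by ring
        rw [e] at h3
        linarith
      have h5 : t (n + 2) ^ 2 ≤ τ * (c * δ) := by
        have e : τ * (c * δ) = (M * τ) * δ / ε := by rw [hc]; ring
        rw [e, le_div_iff₀ hε]
        have hMτ : 0 ≤ M * τ := by positivity
        calc t (n + 2) ^ 2 * ε ≤ (D * (M * τ)) * (t (n + 2) ^ 2 * ε) :=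
              le_mul_of_one_le_left (by positivity) h2
          _ = (M * τ) * (D * (ε * t (n + 2) ^ 2)) := by ring
          _ ≤ (M * τ) * δ := mul_le_mul_of_nonneg_left h4 hMτ
      have hδ0 : 0 ≤ δ := le_trans (by positivity) h4
      have h6 : t (n + 2) ^ 2 ≤ (1 / 4 * τ + c * δ) ^ 2 := by
        nlinarith [sq_nonneg (1 / 4 * τ - c * δ)]
      exact (sq_le_sq₀ (ht _) (by positivity)).1 h6
  set w : ℕ → ℝ := fun n => c * ρ (E n - ℓ) + t (n + 1) + 3 / 4 * t n with hw
  have hw0 : ∀ n, n₀ ≤ n → 0 ≤ w n := fun n hn => by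
    have h1 := hd.nonneg _ (hmem n hn)
    have h2 := ht n
    have h3 := ht (n + 1)
    positivity
  have hsum : ∀ m, 1 / 2 * ∑ i ∈ Finset.range m, t (i + n₀) + w (m + n₀) ≤ w n₀ := by
    intro m
    induction m with
    | zero => simp
    | succ m ih =>
      have := key (m + n₀) (by omega)
      rw [Finset.sum_range_succ]
      have e : m + 1 + n₀ = m + n₀ + 1 := by omega
      simp only [hw, e] at ih ⊢
      rw [show m + n₀ + 1 + 1 = m + n₀ + 2 by omega]
      have := ht (m + n₀)
      nlinarith
  rw [← summable_nat_add_iff n₀]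
  refine summable_of_sum_range_le (c := 2 * w n₀) (fun n => ht _) fun m => ?_
  linarith [hsum m, hw0 (m + n₀) (by omega)]

/-! ### Subdifferentials and the Kurdyka–Łojasiewicz inequality -/

section Subdifferential

variable {E X : Type*} [NormedAddCommGroup E] [InnerProductSpace ℝ E]
  [NormedAddCommGroup X] [InnerProductSpace ℝ X]

theorem mem_frechetSubdiff_of_quadratic_lower_bound {J : E → ℝ} {x g : E} {C : ℝ}
    (h : ∀ y, -(C * ‖y - x‖ ^ 2) ≤ J y - J x - ⟪g, y - x⟫) : g ∈ frechetSubdiff J x := by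
  intro ε hε
  have ht : Filter.Tendsto (fun y : E => C * ‖y - x‖) (𝓝 x) (𝓝 0) := by
    have : Continuous fun y : E => C * ‖y - x‖ := by fun_prop
    simpa using this.tendsto x
  filter_upwards [ht.eventually (gt_mem_nhds hε)] with y hy
  refine le_trans ?_ (h y)
  nlinarith [norm_nonneg (y - x)]

theorem frechetSubdiff_subset_limitSubdiff (J : E → ℝ) (x : E) :
    frechetSubdiff J x ⊆ limitSubdiff J x := fun g hg =>
  ⟨fun _ => x, fun _ => g, tendsto_const_nhds, tendsto_const_nhds, tendsto_const_nhds, fun _ => hg⟩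

variable {J : E → ℝ} {F : WithLp 2 (E × X) → ℝ} {π : E → X} {c : ℝ}

theorem frechetSubdiff_add_sq_dist (hc : 0 ≤ c)
    (hF : ∀ w, F w = J w.fst + c * ‖π w.fst - w.snd‖ ^ 2) {z g : E} (hg : g ∈ frechetSubdiff J z) :
    WithLp.toLp 2 (g, (0 : X)) ∈ frechetSubdiff F (WithLp.toLp 2 (z, π z)) := by
  intro ε hε
  have ht : Filter.Tendsto (fun w : WithLp 2 (E × X) => w.fst)
      (𝓝 (WithLp.toLp 2 (z, π z))) (𝓝 z) :=
    (WithLp.continuous_fst 2 E X).tendsto _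
  filter_upwards [ht.eventually (hg ε hε)] with w hw
  have h1 : ‖w.fst - z‖ ≤ ‖w - WithLp.toLp 2 (z, π z)‖ := by
    simpa using WithLp.norm_fst_le _ (w - WithLp.toLp 2 (z, π z))
  have h2 : 0 ≤ c * ‖π w.fst - w.snd‖ ^ 2 := by positivity
  have h3 : ⟪WithLp.toLp 2 (g, (0 : X)), w - WithLp.toLp 2 (z, π z)⟫ = ⟪g, w.fst - z⟫ := by
    simp [WithLp.prod_inner_apply]
  rw [hF, hF, h3]
  simp only [WithLp.toLp_fst, WithLp.toLp_snd, sub_self, norm_zero]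
  nlinarith

theorem limitSubdiff_add_sq_dist (hc : 0 ≤ c) (hπ : Continuous π)
    (hF : ∀ w, F w = J w.fst + c * ‖π w.fst - w.snd‖ ^ 2) {z g : E} (hg : g ∈ limitSubdiff J z) :
    WithLp.toLp 2 (g, (0 : X)) ∈ limitSubdiff F (WithLp.toLp 2 (z, π z)) := by
  obtain ⟨xs, gs, hxs, hJ, hgs, hmem⟩ := hg
  refine ⟨fun k => WithLp.toLp 2 (xs k, π (xs k)), fun k => WithLp.toLp 2 (gs k, (0 : X)), ?_, ?_,
    ?_, fun k => frechetSubdiff_add_sq_dist hc hF (hmem k)⟩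
  · exact ((WithLp.prod_continuous_toLp 2 E X).tendsto _).comp
      (hxs.prodMk_nhds ((hπ.tendsto _).comp hxs))
  · simpa [hF] using hJ
  · exact ((WithLp.prod_continuous_toLp 2 E X).tendsto _).comp (hgs.prodMk_nhds tendsto_const_nhds)

theorem IsKLFunction.exists_isDesingularizer (hKL : IsKLFunction F) (hc : 0 ≤ c)
    (hπ : Continuous π) (hF : ∀ w, F w = J w.fst + c * ‖π w.fst - w.snd‖ ^ 2) {z : E}
    (hz : IsCriticalPoint J z) :
    ∃ η ρ d, IsDesingularizer η ρ d ∧ ∃ U ∈ 𝓝 z, ∀ x ∈ U, J z < J x → J x < J z + η →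
      ∀ g ∈ frechetSubdiff J x, 1 ≤ d (J x - J z) * ‖g‖ := by
  obtain ⟨η, hη, U, hU, ρ, -, hconc, hnn, -, hdiff, hpos, hineq⟩ :=
    hKL.2 _ ⟨_, limitSubdiff_add_sq_dist hc hπ hF hz⟩
  refine ⟨η, ρ, deriv ρ, hconc.isDesingularizer hη hnn hdiff hpos,
    {x | WithLp.toLp 2 (x, π x) ∈ U}, ?_, fun x hx h1 h2 g hg => ?_⟩
  · have : Continuous fun x : E => WithLp.toLp 2 (x, π x) :=
      (WithLp.prod_continuous_toLp 2 E X).comp (continuous_id.prodMk hπ)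
    exact this.continuousAt.preimage_mem_nhds hU
  · have hFx : ∀ y, F (WithLp.toLp 2 (y, π y)) = J y := fun y => by simp [hF]
    have h := hineq _ hx (by simpa only [hFx] using h1) (by simpa only [hFx] using h2)
    rw [hFx, hFx] at h
    have hd : 0 < deriv ρ (J x - J z) := hpos _ ⟨by linarith, by linarith⟩
    have hle : Metric.infEDist (0 : WithLp 2 (E × X)) (limitSubdiff F (WithLp.toLp 2 (x, π x)))
        ≤ ENNReal.ofReal ‖g‖ := by
      refine (Metric.infEDist_le_edist_of_mem (frechetSubdiff_subset_limitSubdiff _ _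
        (frechetSubdiff_add_sq_dist hc hF hg))).trans ?_
      rw [edist_comm, edist_dist, dist_zero_right]
      refine ENNReal.ofReal_le_ofReal ?_
      simp
    have h3 := h.trans (mul_le_mul_right hle _)
    rw [← ENNReal.ofReal_mul hd.le] at h3
    exact ENNReal.one_le_ofReal.1 h3

end Subdifferential

/-! ### The augmented Lagrangian of `½‖A u - f‖² + G (T u)` -/

section Lagrangian

variable {U V W : Type*} [NormedAddCommGroup U] [InnerProductSpace ℝ U]
  [NormedAddCommGroup V] [InnerProductSpace ℝ V] [NormedAddCommGroup W] [InnerProductSpace ℝ W]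
  (A : U →L[ℝ] W) (T : U →L[ℝ] V) (f : W) (G : V → ℝ) (δ : ℝ)

/-- The augmented Lagrangian `½‖A u - f‖² + G v - ⟨p, T u - v⟩ + (δ/2)‖T u - v‖²`. -/
def splitLagrangian (u : U) (v p : V) : ℝ :=
  1 / 2 * ‖A u - f‖ ^ 2 + G v - ⟪p, T u - v⟫ + δ / 2 * ‖T u - v‖ ^ 2

theorem splitLagrangian_sub_multiplier (u : U) (v p q : V) :
    splitLagrangian A T f G δ u v q = splitLagrangian A T f G δ u v p - ⟪q - p, T u - v⟫ := by
  simp only [splitLagrangian, inner_sub_left]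
  ring

theorem half_mul_sq_norm_shift {δ : ℝ} (hδ : δ ≠ 0) (p r : V) :
    δ / 2 * ‖r - (1 / δ) • p‖ ^ 2 = δ / 2 * ‖r‖ ^ 2 - ⟪p, r⟫ + ‖p‖ ^ 2 / (2 * δ) := by
  rw [norm_sub_sq_real, inner_smul_right, norm_smul, mul_pow, Real.norm_eq_abs, sq_abs,
    real_inner_comm]
  field_simp

theorem splitLagrangian_eq_prox {δ : ℝ} (hδ : δ ≠ 0) (u : U) (v p : V) :
    splitLagrangian A T f G δ u v p = 1 / 2 * ‖A u - f‖ ^ 2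
      + (G v + δ / 2 * ‖T u - (1 / δ) • p - v‖ ^ 2) - ‖p‖ ^ 2 / (2 * δ) := by
  have h := half_mul_sq_norm_shift hδ p (T u - v)
  rw [show T u - (1 / δ) • p - v = T u - v - (1 / δ) • p by abel, h]
  simp only [splitLagrangian]
  ring

variable [CompleteSpace U] [CompleteSpace V] [CompleteSpace W]

theorem splitLagrangian_eq_add_of_stationary {u : U} {v p : V}
    (h : A.adjoint (A u - f) = T.adjoint (p - δ • (T u - v))) (x : U) :
    splitLagrangian A T f G δ x v p = splitLagrangian A T f G δ u v p
      + 1 / 2 * ‖A (x - u)‖ ^ 2 + δ / 2 * ‖T (x - u)‖ ^ 2 := by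
  have h1 : ⟪A u - f, A (x - u)⟫ = ⟪p, T (x - u)⟫ - δ * ⟪T u - v, T (x - u)⟫ := by
    rw [← ContinuousLinearMap.adjoint_inner_left, h, ContinuousLinearMap.adjoint_inner_left,
      inner_sub_left, real_inner_smul_left]
  have e1 : A x - f = (A u - f) + A (x - u) := by rw [map_sub]; abel
  have e2 : T x - v = (T u - v) + T (x - u) := by rw [map_sub]; abel
  simp only [splitLagrangian]
  rw [e1, e2, norm_add_sq_real, norm_add_sq_real, inner_add_right, h1]
  ring

/-- The gradient of the smooth part plus a quadratic-type subgradient of `G`. -/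
theorem mem_frechetSubdiff_splitLagrangian {δ C : ℝ} (hδ : 1 ≤ δ) (hC : 0 ≤ C) {u : U}
    {v p s : V} (hs : ∀ y, G v + ⟪s, y - v⟫ - C * ‖y - v‖ ^ 2 ≤ G y) :
    WithLp.toLp 2 (A.adjoint (A u - f) - T.adjoint p + δ • T.adjoint (T u - v),
        WithLp.toLp 2 (s + p - δ • (T u - v), -(T u - v))) ∈
      frechetSubdiff (fun z : WithLp 2 (U × WithLp 2 (V × V)) =>
        splitLagrangian A T f G δ z.fst z.snd.fst z.snd.snd)
        (WithLp.toLp 2 (u, WithLp.toLp 2 (v, p))) := by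
  refine mem_frechetSubdiff_of_quadratic_lower_bound (C := 1 / 2 + C) fun z => ?_
  obtain ⟨a, b, c, rfl⟩ : ∃ a b c, z = WithLp.toLp 2 (u + a, WithLp.toLp 2 (v + b, p + c)) :=
    ⟨z.fst - u, z.snd.fst - v, z.snd.snd - p, by simp only [add_sub_cancel]; rfl⟩
  have hz : WithLp.toLp 2 (u + a, WithLp.toLp 2 (v + b, p + c))
      - WithLp.toLp 2 (u, WithLp.toLp 2 (v, p)) = WithLp.toLp 2 (a, WithLp.toLp 2 (b, c)) := by
    rw [← WithLp.toLp_sub, Prod.mk_sub_mk, ← WithLp.toLp_sub, Prod.mk_sub_mk]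
    simp only [add_sub_cancel_left]
  rw [hz]
  have hs' := hs (v + b)
  rw [add_sub_cancel_left] at hs'
  simp only [WithLp.prod_inner_apply, WithLp.prod_norm_sq_eq_of_L2, WithLp.toLp_fst,
    WithLp.toLp_snd, splitLagrangian]
  have e1 : A (u + a) - f = (A u - f) + A a := by rw [map_add]; abel
  have e2 : T (u + a) - (v + b) = (T u - v) + (T a - b) := by rw [map_add]; abel
  rw [e1, e2]
  set r := T u - v with hr
  have i1 : ⟪A.adjoint (A u - f) - T.adjoint p + δ • T.adjoint r, a⟫
      = ⟪A u - f, A a⟫ - ⟪p, T a⟫ + δ * ⟪r, T a⟫ := by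
    rw [inner_add_left, inner_sub_left, real_inner_smul_left,
      ContinuousLinearMap.adjoint_inner_left, ContinuousLinearMap.adjoint_inner_left,
      ContinuousLinearMap.adjoint_inner_left]
  have i2 : ⟪s + p - δ • r, b⟫ = ⟪s, b⟫ + ⟪p, b⟫ - δ * ⟪r, b⟫ := by
    rw [inner_sub_left, inner_add_left, real_inner_smul_left]
  have i3 : ⟪-r, c⟫ = -⟪c, r⟫ := by rw [inner_neg_left, real_inner_comm]
  rw [i1, i2, i3, norm_add_sq_real, norm_add_sq_real, inner_add_left, inner_add_right p,
    inner_add_right c, inner_sub_right p (T a) b, inner_sub_right r (T a) b]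
  have h1 : ⟪c, T a - b⟫ ≤ 1 / 2 * ‖c‖ ^ 2 + δ / 2 * ‖T a - b‖ ^ 2 := by
    have := real_inner_le_norm c (T a - b)
    nlinarith [sq_nonneg (‖c‖ - ‖T a - b‖), sq_nonneg ‖T a - b‖]
  have h2 : 0 ≤ ‖A a‖ ^ 2 := by positivity
  have h3 : 0 ≤ (1 / 2 + C) * ‖a‖ ^ 2 := by positivity
  have h4 : 0 ≤ C * ‖c‖ ^ 2 := by positivity
  have h5 : 0 ≤ ‖b‖ ^ 2 := by positivity
  nlinarith

/-! ### The inertial ADMM -/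

/-- The optimality conditions satisfied by the iterates of the inertial ADMM. -/
structure IsInertialADMM (α : ℝ) (u : ℕ → U) (v p : ℕ → V) : Prop where
  stationary : ∀ n, A.adjoint (A (u n) - f) = T.adjoint (p n)
  dual : ∀ n, δ • (T (u (n + 2)) - v (n + 2)) = extrap α p n - p (n + 2)
  prox : ∀ n y, G (v (n + 2)) + δ / 2 * ‖T (u (n + 1)) - (1 / δ) • extrap α p n - v (n + 2)‖ ^ 2
    ≤ G y + δ / 2 * ‖T (u (n + 1)) - (1 / δ) • extrap α p n - y‖ ^ 2

namespace IsInertialADMM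

variable {A T f G δ} {α θ ν : ℝ} {u : ℕ → U} {v p : ℕ → V}

theorem norm_dual_succ_sub_le (h : IsInertialADMM A T f G δ α u v p) (hθ0 : 0 ≤ θ)
    (hθ : ∀ q, ‖q‖ ≤ θ * ‖T.adjoint q‖) (n : ℕ) :
    ‖p (n + 1) - p n‖ ≤ θ * ‖A‖ ^ 2 * ‖u (n + 1) - u n‖ := by
  refine (hθ _).trans ?_
  rw [map_sub, ← h.stationary, ← h.stationary, ← map_sub,
    show A (u (n + 1)) - f - (A (u n) - f) = A (u (n + 1) - u n) by rw [map_sub]; abel, mul_assoc]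
  refine mul_le_mul_of_nonneg_left ?_ hθ0
  calc ‖A.adjoint (A (u (n + 1) - u n))‖ ≤ ‖A.adjoint‖ * ‖A (u (n + 1) - u n)‖ :=
        A.adjoint.le_opNorm _
    _ ≤ ‖A‖ * (‖A‖ * ‖u (n + 1) - u n‖) := by
        rw [LinearIsometryEquiv.norm_map]
        exact mul_le_mul_of_nonneg_left (A.le_opNorm _) (norm_nonneg _)
    _ = ‖A‖ ^ 2 * ‖u (n + 1) - u n‖ := by ring

theorem residual_eq (h : IsInertialADMM A T f G δ α u v p) (hδ : δ ≠ 0) (n : ℕ) :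
    T (u (n + 2)) - v (n + 2)
      = (1 / δ) • (α • (p (n + 1) - p n) - (p (n + 2) - p (n + 1))) := by
  have := h.dual n
  rw [← inv_smul_smul₀ hδ (T (u (n + 2)) - v (n + 2)), this, extrap, one_div]
  congr 1
  abel

/-- One iteration, before the multipliers are estimated. -/
theorem splitLagrangian_succ_le (h : IsInertialADMM A T f G δ α u v p) (hδ : 1 ≤ δ)
    (hν : ∀ x, ν * ‖x‖ ^ 2 ≤ ‖A x‖ ^ 2 + ‖T x‖ ^ 2) (n : ℕ) :
    splitLagrangian A T f G δ (u (n + 3)) (v (n + 3)) (p (n + 3))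
      ≤ splitLagrangian A T f G δ (u (n + 2)) (v (n + 2)) (p (n + 2))
        - ν / 2 * ‖u (n + 3) - u (n + 2)‖ ^ 2
        + 1 / δ * ‖(p (n + 3) - p (n + 2)) - α • (p (n + 2) - p (n + 1))‖ ^ 2
        + α / δ * ‖p (n + 2) - p (n + 1)‖ ^ 2
        - α ^ 2 / δ * ⟪p (n + 2) - p (n + 1), p (n + 1) - p n⟫ := by
  have hδ0 : δ ≠ 0 := by linarith
  set q := extrap α p (n + 1) with hq
  have hq' : q = p (n + 2) + α • (p (n + 2) - p (n + 1)) := rfl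
  have hv : splitLagrangian A T f G δ (u (n + 2)) (v (n + 3)) q
      ≤ splitLagrangian A T f G δ (u (n + 2)) (v (n + 2)) q := by
    rw [splitLagrangian_eq_prox A T f G hδ0, splitLagrangian_eq_prox A T f G hδ0]
    linarith [h.prox (n + 1) (v (n + 2))]
  have hd := h.dual (n + 1)
  rw [← hq] at hd
  have hu := splitLagrangian_eq_add_of_stationary A T f G δ (u := u (n + 3)) (v := v (n + 3))
    (p := q) (by rw [hd, sub_sub_cancel]; exact h.stationary (n + 3)) (u (n + 2))
  have hν' := hν (u (n + 2) - u (n + 3))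
  rw [norm_sub_rev] at hν'
  have h3 := splitLagrangian_sub_multiplier A T f G δ (u (n + 3)) (v (n + 3)) (p (n + 3)) q
  have h2 := splitLagrangian_sub_multiplier A T f G δ (u (n + 2)) (v (n + 2)) (p (n + 2)) q
  have i3 : ⟪q - p (n + 3), T (u (n + 3)) - v (n + 3)⟫
      = 1 / δ * ‖(p (n + 3) - p (n + 2)) - α • (p (n + 2) - p (n + 1))‖ ^ 2 := by
    rw [h.residual_eq hδ0 (n + 1), inner_smul_right, hq', ← real_inner_self_eq_norm_sq]
    congr 1
    rw [← inner_neg_neg]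
    congr 1 <;> abel
  have i2 : ⟪q - p (n + 2), T (u (n + 2)) - v (n + 2)⟫
      = α ^ 2 / δ * ⟪p (n + 2) - p (n + 1), p (n + 1) - p n⟫
        - α / δ * ‖p (n + 2) - p (n + 1)‖ ^ 2 := by
    rw [h.residual_eq hδ0 n, hq', add_sub_cancel_left, inner_smul_right, real_inner_smul_left,
      inner_sub_right, inner_smul_right, real_inner_self_eq_norm_sq]
    ring
  rw [i3] at h3
  rw [i2] at h2
  have hT : ‖T (u (n + 2) - u (n + 3))‖ ^ 2 ≤ δ * ‖T (u (n + 2) - u (n + 3))‖ ^ 2 :=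
    le_mul_of_one_le_left (by positivity) hδ
  linarith

/-- The energy that decreases along the iteration. -/
def energy (A : U →L[ℝ] W) (T : U →L[ℝ] V) (f : W) (G : V → ℝ) (δ α θ : ℝ) (u : ℕ → U)
    (v p : ℕ → V) (n : ℕ) : ℝ :=
  splitLagrangian A T f G δ (u (n + 2)) (v (n + 2)) (p (n + 2))
    + (3 * α ^ 2 + α) * (θ ^ 2 * ‖A‖ ^ 4) / δ * ‖u (n + 2) - u (n + 1)‖ ^ 2
    + α ^ 2 * (θ ^ 2 * ‖A‖ ^ 4) / (2 * δ) * ‖u (n + 1) - u n‖ ^ 2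

theorem energy_succ_le (h : IsInertialADMM A T f G δ α u v p) (hα : 0 ≤ α) (hδ : 1 ≤ δ)
    (hν : ∀ x, ν * ‖x‖ ^ 2 ≤ ‖A x‖ ^ 2 + ‖T x‖ ^ 2) (hθ0 : 0 ≤ θ)
    (hθ : ∀ q, ‖q‖ ≤ θ * ‖T.adjoint q‖) (n : ℕ) :
    (ν / 2 - (2 + α + 3 * α ^ 2) * (θ ^ 2 * ‖A‖ ^ 4) / δ) * ‖u (n + 3) - u (n + 2)‖ ^ 2
      ≤ energy A T f G δ α θ u v p n - energy A T f G δ α θ u v p (n + 1) := by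
  have h0 := h.splitLagrangian_succ_le hδ hν n
  have hsq : ∀ m, ‖p (m + 1) - p m‖ ^ 2 ≤ θ ^ 2 * ‖A‖ ^ 4 * ‖u (m + 1) - u m‖ ^ 2 := fun m => by
    have := pow_le_pow_left₀ (norm_nonneg _) (h.norm_dual_succ_sub_le hθ0 hθ m) 2
    calc _ ≤ _ := this
      _ = _ := by ring
  have a1 := hsq n
  have a2 := hsq (n + 1)
  have a3 := hsq (n + 2)
  have b1 : ‖(p (n + 3) - p (n + 2)) - α • (p (n + 2) - p (n + 1))‖ ^ 2
      ≤ 2 * ‖p (n + 3) - p (n + 2)‖ ^ 2 + 2 * α ^ 2 * ‖p (n + 2) - p (n + 1)‖ ^ 2 := by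
    have := norm_sub_le (p (n + 3) - p (n + 2)) (α • (p (n + 2) - p (n + 1)))
    rw [norm_smul, Real.norm_of_nonneg hα] at this
    have := pow_le_pow_left₀ (norm_nonneg _) this 2
    nlinarith [sq_nonneg (‖p (n + 3) - p (n + 2)‖ - α * ‖p (n + 2) - p (n + 1)‖)]
  have b2 : -⟪p (n + 2) - p (n + 1), p (n + 1) - p n⟫
      ≤ 1 / 2 * ‖p (n + 2) - p (n + 1)‖ ^ 2 + 1 / 2 * ‖p (n + 1) - p n‖ ^ 2 := by
    have := neg_le_of_abs_le (abs_real_inner_le_norm (p (n + 2) - p (n + 1)) (p (n + 1) - p n))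
    nlinarith [sq_nonneg (‖p (n + 2) - p (n + 1)‖ - ‖p (n + 1) - p n‖)]
  have hδ0 : 0 < δ := by linarith
  simp only [energy]
  rw [show n + 1 + 2 = n + 3 by omega, show n + 1 + 1 = n + 2 by omega] at *
  generalize θ ^ 2 * ‖A‖ ^ 4 = C at *
  generalize splitLagrangian A T f G δ (u (n + 3)) (v (n + 3)) (p (n + 3)) = L3 at *
  generalize splitLagrangian A T f G δ (u (n + 2)) (v (n + 2)) (p (n + 2)) = L2 at *
  generalize ‖(p (n + 3) - p (n + 2)) - α • (p (n + 2) - p (n + 1))‖ ^ 2 = X at *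
  generalize ⟪p (n + 2) - p (n + 1), p (n + 1) - p n⟫ = Y at *
  generalize ‖p (n + 3) - p (n + 2)‖ ^ 2 = P3 at *
  generalize ‖p (n + 2) - p (n + 1)‖ ^ 2 = P2 at *
  generalize ‖p (n + 1) - p n‖ ^ 2 = P1 at *
  generalize ‖u (n + 3) - u (n + 2)‖ ^ 2 = U3 at *
  generalize ‖u (n + 2) - u (n + 1)‖ ^ 2 = U2 at *
  generalize ‖u (n + 1) - u n‖ ^ 2 = U1 at *
  have hX : X + α * P2 - α ^ 2 * Y ≤ C * (2 * U3 + (5 / 2 * α ^ 2 + α) * U2 + α ^ 2 / 2 * U1) := by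
    have c1 := mul_le_mul_of_nonneg_left b2 (sq_nonneg α)
    have c2 := mul_le_mul_of_nonneg_left a2 (show 0 ≤ 5 / 2 * α ^ 2 + α by positivity)
    have c3 := mul_le_mul_of_nonneg_left a1 (show 0 ≤ α ^ 2 / 2 by positivity)
    linarith
  have hX' := mul_le_mul_of_nonneg_left hX (one_div_nonneg.2 hδ0.le)
  have e1 : 1 / δ * (X + α * P2 - α ^ 2 * Y) = 1 / δ * X + α / δ * P2 - α ^ 2 / δ * Y := by ring
  rw [e1] at hX'
  have hfin : L3 ≤ L2 - ν / 2 * U3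
      + 1 / δ * (C * (2 * U3 + (5 / 2 * α ^ 2 + α) * U2 + α ^ 2 / 2 * U1)) := by linarith
  refine le_of_sub_nonneg ?_
  have := sub_nonneg.2 hfin
  refine this.trans_eq ?_
  field_simp
  ring

end IsInertialADMM

end Lagrangian

/-- A uniformized Kurdyka–Łojasiewicz inequality along a bounded sequence. -/
theorem exists_isDesingularizer_along_seq {E : Type*} [NormedAddCommGroup E]
    [InnerProductSpace ℝ E] [ProperSpace E] {J : E → ℝ} {z : ℕ → E} {ℓ R : ℝ}
    (hz : ∀ n, ‖z n‖ ≤ R)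
    (hcluster : ∀ x, MapClusterPt x Filter.atTop z → J x = ℓ ∧ IsCriticalPoint J x)
    (hKL : ∀ x, IsCriticalPoint J x → ∃ η ρ d, IsDesingularizer η ρ d ∧ ∃ U ∈ 𝓝 x, ∀ y ∈ U,
      J x < J y → J y < J x + η → ∀ g ∈ frechetSubdiff J y, 1 ≤ d (J y - J x) * ‖g‖) :
    ∃ η ρ d, IsDesingularizer η ρ d ∧ ∀ᶠ n in Filter.atTop, ℓ < J (z n) → J (z n) < ℓ + η →
      ∀ g ∈ frechetSubdiff J (z n), 1 ≤ d (J (z n) - ℓ) * ‖g‖ := by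
  have key := (isCompact_closedBall (0 : E) R).induction_on
    (p := fun S => ∃ η ρ d, IsDesingularizer η ρ d ∧ ∀ᶠ n in Filter.atTop, z n ∈ S →
      ℓ < J (z n) → J (z n) < ℓ + η → ∀ g ∈ frechetSubdiff J (z n), 1 ≤ d (J (z n) - ℓ) * ‖g‖)
    ⟨1, _, _, .const_one one_pos, by simp⟩ ?_ ?_ ?_
  · obtain ⟨η, ρ, d, hd, hev⟩ := key
    exact ⟨η, ρ, d, hd, hev.mono fun n hn => hn (by simpa using hz n)⟩
  · rintro S S' hSS' ⟨η, ρ, d, hd, hev⟩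
    exact ⟨η, ρ, d, hd, hev.mono fun n hn hS => hn (hSS' hS)⟩
  · rintro S₁ S₂ ⟨η₁, ρ₁, d₁, hd₁, hev₁⟩ ⟨η₂, ρ₂, d₂, hd₂, hev₂⟩
    have hη : 0 < min η₁ η₂ := lt_min hd₁.pos hd₂.pos
    have h₁ := hd₁.mono hη (min_le_left _ _)
    have h₂ := hd₂.mono hη (min_le_right _ _)
    refine ⟨_, _, _, h₁.add h₂, ?_⟩
    filter_upwards [hev₁, hev₂] with n hn₁ hn₂ hS hℓ hlt g hg
    have hm : J (z n) - ℓ ∈ Set.Ioo 0 (min η₁ η₂) := ⟨by linarith, by linarith⟩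
    have p₁ := mul_nonneg (h₁.slope_nonneg _ hm) (norm_nonneg g)
    have p₂ := mul_nonneg (h₂.slope_nonneg _ hm) (norm_nonneg g)
    rw [add_mul]
    rcases hS with hS | hS
    · have := hn₁ hS hℓ (hlt.trans_le (by linarith [min_le_left η₁ η₂])) g hg
      linarith
    · have := hn₂ hS hℓ (hlt.trans_le (by linarith [min_le_right η₁ η₂])) g hg
      linarith
  · intro x _
    by_cases hx : MapClusterPt x Filter.atTop z
    · obtain ⟨hJ, hcrit⟩ := hcluster x hx
      obtain ⟨η, ρ, d, hd, U, hU, hineq⟩ := hKL x hcrit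
      rw [hJ] at hineq
      exact ⟨U, mem_nhdsWithin_of_mem_nhds hU, η, ρ, d, hd,
        Filter.Eventually.of_forall fun n hn => hineq _ hn⟩
    · simp only [mapClusterPt_iff_frequently, not_forall, Filter.not_frequently] at hx
      obtain ⟨U, hU, hev⟩ := hx
      exact ⟨U, mem_nhdsWithin_of_mem_nhds hU, 1, _, _, .const_one one_pos,
        hev.mono fun n hn hn' => absurd hn' hn⟩

theorem norm_toLp_prod_le {U V : Type*} [NormedAddCommGroup U] [NormedAddCommGroup V]
    (a : U) (b c : V) :
    ‖WithLp.toLp 2 (a, WithLp.toLp 2 (b, c))‖ ≤ ‖a‖ + (‖b‖ + ‖c‖) := by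
  refine abs_le_of_sq_le_sq' ?_ (by positivity) |>.2
  rw [WithLp.prod_norm_sq_eq_of_L2, WithLp.prod_norm_sq_eq_of_L2]
  simp only [WithLp.toLp_fst, WithLp.toLp_snd]
  nlinarith [mul_nonneg (norm_nonneg a) (add_nonneg (norm_nonneg b) (norm_nonneg c)),
    mul_nonneg (norm_nonneg b) (norm_nonneg c)]

section Lagrangian

variable {U V W : Type*} [NormedAddCommGroup U] [InnerProductSpace ℝ U]
  [NormedAddCommGroup V] [InnerProductSpace ℝ V] [NormedAddCommGroup W] [InnerProductSpace ℝ W]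
  {A : U →L[ℝ] W} {T : U →L[ℝ] V} {f : W} {G : V → ℝ} {δ : ℝ}

/-- The augmented Lagrangian as a function of the triple `(u, v, p)`. -/
def liftedLagrangian (A : U →L[ℝ] W) (T : U →L[ℝ] V) (f : W) (G : V → ℝ) (δ : ℝ)
    (z : WithLp 2 (U × WithLp 2 (V × V))) : ℝ :=
  splitLagrangian A T f G δ z.fst z.snd.fst z.snd.snd

variable [CompleteSpace U] [CompleteSpace V] [CompleteSpace W] {α θ ν m : ℝ}

theorem sq_add_le_splitLagrangian (hδ : 1 ≤ δ) (hθ0 : 0 ≤ θ)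
    (hθ : ∀ q, ‖q‖ ≤ θ * ‖T.adjoint q‖) (hδθ : 2 * (θ ^ 2 * ‖A‖ ^ 2) ≤ δ) {u : U} {v p : V}
    (hst : A.adjoint (A u - f) = T.adjoint p) :
    1 / 4 * ‖A u - f‖ ^ 2 + G v + δ / 2 * ‖T u - v - (1 / δ) • p‖ ^ 2
      ≤ splitLagrangian A T f G δ u v p := by
  have h1 : ‖p‖ ≤ θ * (‖A‖ * ‖A u - f‖) := by
    refine (hθ p).trans (mul_le_mul_of_nonneg_left ?_ hθ0)
    rw [← hst]
    refine (A.adjoint.le_opNorm _).trans ?_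
    rw [LinearIsometryEquiv.norm_map]
  have h2 : ‖p‖ ^ 2 / (2 * δ) ≤ 1 / 4 * ‖A u - f‖ ^ 2 := by
    rw [div_le_iff₀ (by positivity)]
    have h3 := pow_le_pow_left₀ (norm_nonneg _) h1 2
    have h4 := mul_le_mul_of_nonneg_right hδθ (sq_nonneg ‖A u - f‖)
    nlinarith
  rw [half_mul_sq_norm_shift (by linarith)]
  simp only [splitLagrangian]
  linarith

theorem exists_bound_of_splitLagrangian_le (hδ : 1 ≤ δ) (hν0 : 0 < ν)
    (hν : ∀ x, ν * ‖x‖ ^ 2 ≤ ‖A x‖ ^ 2 + ‖T x‖ ^ 2) (hθ0 : 0 ≤ θ)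
    (hθ : ∀ q, ‖q‖ ≤ θ * ‖T.adjoint q‖) (hδθ : 2 * (θ ^ 2 * ‖A‖ ^ 2) ≤ δ)
    (hm : ∀ y, m ≤ G y) (hcoer : ∀ c, Bornology.IsBounded {y | G y ≤ c}) (c : ℝ) :
    ∃ R, ∀ u v p, A.adjoint (A u - f) = T.adjoint p → splitLagrangian A T f G δ u v p ≤ c →
      ‖WithLp.toLp 2 (u, WithLp.toLp 2 (v, p))‖ ≤ R := by
  obtain ⟨Rv, hRv⟩ := (hcoer c).exists_norm_le
  set a₀ := √(4 * (c - m)) with ha₀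
  set b₀ := √(2 * (c - m)) with hb₀
  set Rp := θ * (‖A‖ * a₀) with hRp
  refine ⟨√(((a₀ + ‖f‖) ^ 2 + (b₀ + Rp + Rv) ^ 2) / ν) + (Rv + Rp), fun u v p hst hL => ?_⟩
  have h0 := (sq_add_le_splitLagrangian hδ hθ0 hθ hδθ (G := G) (v := v) hst).trans hL
  have hw : 0 ≤ ‖T u - v - (1 / δ) • p‖ ^ 2 := by positivity
  have hw' : ‖T u - v - (1 / δ) • p‖ ^ 2 ≤ δ * ‖T u - v - (1 / δ) • p‖ ^ 2 :=
    le_mul_of_one_le_left hw hδ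
  have hmv := hm v
  have ha : ‖A u - f‖ ≤ a₀ := Real.le_sqrt_of_sq_le (by linarith)
  have hb : ‖T u - v - (1 / δ) • p‖ ≤ b₀ :=
    Real.le_sqrt_of_sq_le (by linarith [sq_nonneg ‖A u - f‖])
  have hv : ‖v‖ ≤ Rv := hRv v (show G v ≤ c by linarith [sq_nonneg ‖A u - f‖])
  have hp : ‖p‖ ≤ Rp := by
    refine (hθ p).trans (mul_le_mul_of_nonneg_left ?_ hθ0)
    rw [← hst]
    refine (A.adjoint.le_opNorm _).trans ?_
    rw [LinearIsometryEquiv.norm_map]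
    exact mul_le_mul_of_nonneg_left ha (norm_nonneg _)
  have hA : ‖A u‖ ≤ a₀ + ‖f‖ := by
    have := norm_add_le (A u - f) f
    rw [sub_add_cancel] at this
    linarith
  have hT : ‖T u‖ ≤ b₀ + Rp + Rv := by
    have h1 : T u = (T u - v - (1 / δ) • p) + (1 / δ) • p + v := by abel
    have h2 : ‖(1 / δ) • p‖ ≤ ‖p‖ := by
      rw [norm_smul, Real.norm_of_nonneg (by positivity)]
      exact mul_le_of_le_one_left (norm_nonneg _) ((div_le_one (by linarith)).2 hδ)
    rw [h1]
    exact (norm_add₃_le).trans (by linarith)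
  have hu : ‖u‖ ≤ √(((a₀ + ‖f‖) ^ 2 + (b₀ + Rp + Rv) ^ 2) / ν) := by
    refine Real.le_sqrt_of_sq_le ?_
    rw [le_div_iff₀ hν0, mul_comm]
    refine (hν u).trans (add_le_add ?_ ?_)
    · exact pow_le_pow_left₀ (norm_nonneg _) hA 2
    · exact pow_le_pow_left₀ (norm_nonneg _) hT 2
  exact (norm_toLp_prod_le u v p).trans (add_le_add hu (add_le_add hv hp))

namespace IsInertialADMM

variable {u : ℕ → U} {v p : ℕ → V}

theorem norm_residual_le (h : IsInertialADMM A T f G δ α u v p) (hα : 0 ≤ α) (hδ : 1 ≤ δ)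
    (hθ0 : 0 ≤ θ) (hθ : ∀ q, ‖q‖ ≤ θ * ‖T.adjoint q‖) (n : ℕ) :
    ‖T (u (n + 2)) - v (n + 2)‖
      ≤ (α + 1) * (θ * ‖A‖ ^ 2) * (‖u (n + 2) - u (n + 1)‖ + ‖u (n + 1) - u n‖) := by
  rw [h.residual_eq (by linarith), norm_smul, Real.norm_of_nonneg (by positivity)]
  have h1 := h.norm_dual_succ_sub_le hθ0 hθ n
  have h2 := h.norm_dual_succ_sub_le hθ0 hθ (n + 1)
  have h3 := norm_sub_le (α • (p (n + 1) - p n)) (p (n + 2) - p (n + 1))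
  rw [norm_smul, Real.norm_of_nonneg hα] at h3
  have h4 := mul_le_mul_of_nonneg_left h1 hα
  have hc : 0 ≤ θ * ‖A‖ ^ 2 := by positivity
  have h5 := mul_nonneg hc (norm_nonneg (u (n + 1) - u n))
  have h6 := mul_nonneg hα (mul_nonneg hc (norm_nonneg (u (n + 2) - u (n + 1))))
  refine (mul_le_of_le_one_left (norm_nonneg _) ((div_le_one (by linarith)).2 hδ)).trans ?_
  rw [show n + 1 + 1 = n + 2 by omega] at h2
  nlinarith

theorem exists_mem_frechetSubdiff (h : IsInertialADMM A T f G δ α u v p) (hα : 0 ≤ α)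
    (hδ : 1 ≤ δ) (hθ0 : 0 ≤ θ) (hθ : ∀ q, ‖q‖ ≤ θ * ‖T.adjoint q‖) (n : ℕ) :
    ∃ g ∈ frechetSubdiff (liftedLagrangian A T f G δ)
        (WithLp.toLp 2 (u (n + 2), WithLp.toLp 2 (v (n + 2), p (n + 2)))),
      ‖g‖ ≤ ((δ * ‖T‖ + δ + 1) * ((α + 1) * (θ * ‖A‖ ^ 2)) + δ * ‖T‖)
        * (‖u (n + 2) - u (n + 1)‖ + ‖u (n + 1) - u n‖) := by
  have hδ0 : δ ≠ 0 := by linarith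
  set c := T (u (n + 1)) - (1 / δ) • extrap α p n with hc
  have hs : ∀ y, G (v (n + 2)) + ⟪δ • (c - v (n + 2)), y - v (n + 2)⟫
      - δ / 2 * ‖y - v (n + 2)‖ ^ 2 ≤ G y := fun y => by
    have h1 := h.prox n y
    rw [← hc, show c - y = (c - v (n + 2)) - (y - v (n + 2)) by abel,
      norm_sub_sq_real (c - v (n + 2))] at h1
    rw [real_inner_smul_left]
    linarith
  refine ⟨_, mem_frechetSubdiff_splitLagrangian A T f G hδ (by positivity) (u := u (n + 2))
    (p := p (n + 2)) hs, ?_⟩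
  have hr := h.norm_residual_le hα hδ hθ0 hθ n
  have e2 : δ • (c - v (n + 2)) + p (n + 2) - δ • (T (u (n + 2)) - v (n + 2))
      = -(δ • T (u (n + 2) - u (n + 1))) - δ • (T (u (n + 2)) - v (n + 2)) := by
    have := h.dual n
    have e3 : extrap α p n = δ • (T (u (n + 2)) - v (n + 2)) + p (n + 2) := by rw [this]; abel
    rw [hc, e3, smul_add, one_div, inv_smul_smul₀ hδ0]
    simp only [smul_sub, smul_add, smul_inv_smul₀ hδ0, map_sub]
    abel
  rw [h.stationary, sub_self, zero_add, e2]
  refine (norm_toLp_prod_le _ _ _).trans ?_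
  set r := T (u (n + 2)) - v (n + 2) with hrdef
  set t₂ := ‖u (n + 2) - u (n + 1)‖ with ht₂
  have ht₁ := norm_nonneg (u (n + 1) - u n)
  set t₁ := ‖u (n + 1) - u n‖
  have hδ' : 0 ≤ δ := by linarith
  have n1 : ‖δ • T.adjoint r‖ ≤ δ * ‖T‖ * ‖r‖ := by
    rw [norm_smul, Real.norm_of_nonneg hδ', mul_assoc]
    refine mul_le_mul_of_nonneg_left ((T.adjoint.le_opNorm _).trans ?_) hδ'
    rw [LinearIsometryEquiv.norm_map]
  have n2 : ‖-(δ • T (u (n + 2) - u (n + 1))) - δ • r‖ ≤ δ * ‖T‖ * t₂ + δ * ‖r‖ := by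
    refine (norm_sub_le _ _).trans ?_
    rw [norm_neg, norm_smul, norm_smul, Real.norm_of_nonneg hδ', mul_assoc]
    gcongr
    exact T.le_opNorm _
  rw [norm_neg]
  have n3 : (δ * ‖T‖ + δ + 1) * ‖r‖
      ≤ (δ * ‖T‖ + δ + 1) * ((α + 1) * (θ * ‖A‖ ^ 2) * (t₂ + t₁)) :=
    mul_le_mul_of_nonneg_left hr (by positivity)
  have n4 : 0 ≤ δ * ‖T‖ * t₁ := by positivity
  linarith

end IsInertialADMM

end Lagrangian

/-! ### Convergence of the inertial ADMM -/

section Convergence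

open Filter

variable {U V W : Type*} [NormedAddCommGroup U] [InnerProductSpace ℝ U]
  [NormedAddCommGroup V] [InnerProductSpace ℝ V] [NormedAddCommGroup W] [InnerProductSpace ℝ W]
  [CompleteSpace U] [CompleteSpace V] [CompleteSpace W]
  {A : U →L[ℝ] W} {T : U →L[ℝ] V} {f : W} {G : V → ℝ} {δ α θ ν ε ℓ : ℝ}
  {u : ℕ → U} {v p : ℕ → V}

namespace IsInertialADMM

theorem tendsto_dual_succ_sub (h : IsInertialADMM A T f G δ α u v p) (hθ0 : 0 ≤ θ)
    (hθ : ∀ q, ‖q‖ ≤ θ * ‖T.adjoint q‖)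
    (ht : Tendsto (fun n => ‖u (n + 1) - u n‖) atTop (𝓝 0)) :
    Tendsto (fun n => p (n + 1) - p n) atTop (𝓝 0) :=
  squeeze_zero_norm (h.norm_dual_succ_sub_le hθ0 hθ) (by simpa using ht.const_mul (θ * ‖A‖ ^ 2))

theorem tendsto_residual (h : IsInertialADMM A T f G δ α u v p) (hα : 0 ≤ α) (hδ : 1 ≤ δ)
    (hθ0 : 0 ≤ θ) (hθ : ∀ q, ‖q‖ ≤ θ * ‖T.adjoint q‖)
    (ht : Tendsto (fun n => ‖u (n + 1) - u n‖) atTop (𝓝 0)) :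
    Tendsto (fun n => T (u (n + 2)) - v (n + 2)) atTop (𝓝 0) := by
  refine squeeze_zero_norm (h.norm_residual_le hα hδ hθ0 hθ) ?_
  have := ((ht.comp (tendsto_add_atTop_nat 1)).add ht).const_mul ((α + 1) * (θ * ‖A‖ ^ 2))
  simpa using this

/-- Limits of subsequences are critical, and the Lagrangian takes the limiting value there. -/
theorem isCriticalPoint_of_tendsto_subseq (h : IsInertialADMM A T f G δ α u v p) (hα : 0 ≤ α)
    (hδ : 1 ≤ δ) (hθ0 : 0 ≤ θ) (hθ : ∀ q, ‖q‖ ≤ θ * ‖T.adjoint q‖)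
    (hG : LowerSemicontinuous G)
    (ht : Tendsto (fun n => ‖u (n + 1) - u n‖) atTop (𝓝 0))
    (hL : Tendsto (fun n => splitLagrangian A T f G δ (u (n + 2)) (v (n + 2)) (p (n + 2))) atTop
      (𝓝 ℓ))
    {ψ : ℕ → ℕ} (hψ : StrictMono ψ) {x : WithLp 2 (U × WithLp 2 (V × V))}
    (hx : Tendsto (fun n => WithLp.toLp 2 (u (ψ n + 2), WithLp.toLp 2 (v (ψ n + 2), p (ψ n + 2))))
      atTop (𝓝 x)) :
    liftedLagrangian A T f G δ x = ℓ ∧ IsCriticalPoint (liftedLagrangian A T f G δ) x := by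
  have hψt := hψ.tendsto_atTop
  have hu : Tendsto (fun n => u (ψ n + 2)) atTop (𝓝 x.fst) :=
    ((WithLp.continuous_fst 2 _ _).tendsto x).comp hx
  have hs := ((WithLp.continuous_snd 2 _ _).tendsto x).comp hx
  have hv : Tendsto (fun n => v (ψ n + 2)) atTop (𝓝 x.snd.fst) :=
    ((WithLp.continuous_fst 2 _ _).tendsto _).comp hs
  have hp : Tendsto (fun n => p (ψ n + 2)) atTop (𝓝 x.snd.snd) :=
    ((WithLp.continuous_snd 2 _ _).tendsto _).comp hs
  have hΔu : Tendsto (fun n => u (n + 1) - u n) atTop (𝓝 0) :=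
    tendsto_zero_iff_norm_tendsto_zero.2 ht
  have hΔp := h.tendsto_dual_succ_sub hθ0 hθ ht
  have hΔu' := ((hΔu.comp (tendsto_add_atTop_nat 1)).comp hψt)
  have hΔp' := ((hΔp.comp (tendsto_add_atTop_nat 1)).comp hψt)
  have hΔp'' := hΔp.comp hψt
  have hu1 : Tendsto (fun n => u (ψ n + 1)) atTop (𝓝 x.fst) := by
    have := hu.sub hΔu'
    simpa [Function.comp_def] using this
  have hq : Tendsto (fun n => extrap α p (ψ n)) atTop (𝓝 x.snd.snd) := by
    have := (hp.sub hΔp').add (hΔp''.const_smul α)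
    simpa [Function.comp_def, extrap] using this
  have hc : Tendsto (fun n => T (u (ψ n + 1)) - (1 / δ) • extrap α p (ψ n)) atTop
      (𝓝 (T x.fst - (1 / δ) • x.snd.snd)) :=
    ((T.continuous.tendsto _).comp hu1).sub (hq.const_smul _)
  have hLψ : Tendsto (fun n => splitLagrangian A T f G δ (u (ψ n + 2)) (v (ψ n + 2)) (p (ψ n + 2)))
      atTop (𝓝 ℓ) := hL.comp hψt
  have hr := ((T.continuous.tendsto _).comp hu).sub hv
  have hGlim : Tendsto (fun n => G (v (ψ n + 2))) atTop
      (𝓝 (ℓ - 1 / 2 * ‖A x.fst - f‖ ^ 2 + ⟪x.snd.snd, T x.fst - x.snd.fst⟫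
        - δ / 2 * ‖T x.fst - x.snd.fst‖ ^ 2)) := by
    have h1 := ((((A.continuous.tendsto _).comp hu).sub_const f).norm.pow 2).const_mul (1 / 2)
    have h2 := hp.inner (𝕜 := ℝ) hr
    have h3 := (hr.norm.pow 2).const_mul (δ / 2)
    refine (((hLψ.sub h1).add h2).sub h3).congr fun n => ?_
    simp only [splitLagrangian, Function.comp_def]
    ring
  set γ := ℓ - 1 / 2 * ‖A x.fst - f‖ ^ 2 + ⟪x.snd.snd, T x.fst - x.snd.fst⟫
        - δ / 2 * ‖T x.fst - x.snd.fst‖ ^ 2 with hγ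
  have hle : γ ≤ G x.snd.fst := by
    have h1 := hGlim.add (((hc.sub hv).norm.pow 2).const_mul (δ / 2))
    have h2 := (tendsto_const_nhds (x := G x.snd.fst)).add
      (((hc.sub_const x.snd.fst).norm.pow 2).const_mul (δ / 2))
    have := le_of_tendsto_of_tendsto' h1 h2 fun n => h.prox (ψ n) x.snd.fst
    linarith
  have hge : G x.snd.fst ≤ γ := by
    by_contra! hlt
    obtain ⟨b, hb1, hb2⟩ := exists_between hlt
    have h1 := hv.eventually (hG x.snd.fst b hb2)
    have h2 := hGlim.eventually (gt_mem_nhds hb1)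
    obtain ⟨n, hn1, hn2⟩ := (h1.and h2).exists
    linarith
  have hval : liftedLagrangian A T f G δ x = ℓ := by
    simp only [liftedLagrangian, splitLagrangian]
    linarith
  refine ⟨hval, ?_⟩
  choose g hg hgn using h.exists_mem_frechetSubdiff hα hδ hθ0 hθ
  refine ⟨_, fun n => g (ψ n), hx, ?_, ?_, fun n => hg (ψ n)⟩
  · rw [hval]
    exact hLψ
  · have hg0 : Tendsto g atTop (𝓝 0) := by
      refine squeeze_zero_norm hgn ?_
      have := ((ht.comp (tendsto_add_atTop_nat 1)).add ht).const_mul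
        ((δ * ‖T‖ + δ + 1) * ((α + 1) * (θ * ‖A‖ ^ 2)) + δ * ‖T‖)
      simpa using this
    exact hg0.comp hψt

theorem exists_tendsto_of_summable (h : IsInertialADMM A T f G δ α u v p) (hα : 0 ≤ α)
    (hδ : 1 ≤ δ) (hθ0 : 0 ≤ θ) (hθ : ∀ q, ‖q‖ ≤ θ * ‖T.adjoint q‖)
    (ht : Summable fun n => ‖u (n + 1) - u n‖) :
    ∃ x y q, Tendsto u atTop (𝓝 x) ∧ Tendsto v atTop (𝓝 y) ∧ Tendsto p atTop (𝓝 q) := by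
  obtain ⟨x, hx⟩ := cauchySeq_tendsto_of_complete
    (cauchySeq_of_summable_dist (f := u) (by simpa [dist_eq_norm, norm_sub_rev] using ht))
  have hp : Summable fun n => ‖p (n + 1) - p n‖ :=
    Summable.of_nonneg_of_le (fun _ => norm_nonneg _) (h.norm_dual_succ_sub_le hθ0 hθ)
      (ht.mul_left _)
  obtain ⟨q, hq⟩ := cauchySeq_tendsto_of_complete
    (cauchySeq_of_summable_dist (f := p) (by simpa [dist_eq_norm, norm_sub_rev] using hp))
  refine ⟨x, T x, q, hx, ?_, hq⟩
  have h1 := h.tendsto_residual hα hδ hθ0 hθ ht.tendsto_atTop_zero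
  have h2 : Tendsto (fun n => T (u (n + 2))) atTop (𝓝 (T x)) :=
    (T.continuous.tendsto _).comp ((tendsto_add_atTop_iff_nat 2).2 hx)
  rw [← tendsto_add_atTop_iff_nat 2]
  simpa using h2.sub h1

theorem exists_tendsto_isCriticalPoint [FiniteDimensional ℝ U] [FiniteDimensional ℝ V]
    (h : IsInertialADMM A T f G δ α u v p) (hα : 0 ≤ α) (hδ : 1 ≤ δ) (hν0 : 0 < ν)
    (hν : ∀ x, ν * ‖x‖ ^ 2 ≤ ‖A x‖ ^ 2 + ‖T x‖ ^ 2) (hθ0 : 0 ≤ θ)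
    (hθ : ∀ q, ‖q‖ ≤ θ * ‖T.adjoint q‖) (hδθ : 2 * (θ ^ 2 * ‖A‖ ^ 2) ≤ δ)
    (hδν : (2 + α + 3 * α ^ 2) * (θ ^ 2 * ‖A‖ ^ 4) / δ < ν / 2)
    (hG : LowerSemicontinuous G) {m : ℝ} (hm : ∀ y, m ≤ G y)
    (hcoer : ∀ c, Bornology.IsBounded {y | G y ≤ c})
    (hKL : ∀ x, IsCriticalPoint (liftedLagrangian A T f G δ) x →
      ∃ η ρ d, IsDesingularizer η ρ d ∧ ∃ S ∈ 𝓝 x, ∀ y ∈ S,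
        liftedLagrangian A T f G δ x < liftedLagrangian A T f G δ y →
        liftedLagrangian A T f G δ y < liftedLagrangian A T f G δ x + η →
        ∀ g ∈ frechetSubdiff (liftedLagrangian A T f G δ) y,
          1 ≤ d (liftedLagrangian A T f G δ y - liftedLagrangian A T f G δ x) * ‖g‖) :
    ∃ x y q, Tendsto (fun n => WithLp.toLp 2 (u n, WithLp.toLp 2 (v n, p n))) atTop
        (𝓝 (WithLp.toLp 2 (x, WithLp.toLp 2 (y, q)))) ∧
      IsCriticalPoint (liftedLagrangian A T f G δ) (WithLp.toLp 2 (x, WithLp.toLp 2 (y, q))) := by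
  have hδ0 : 0 < δ := by linarith
  set E := energy A T f G δ α θ u v p with hEdef
  set C := θ ^ 2 * ‖A‖ ^ 4 with hC
  have hC0 : 0 ≤ C := by positivity
  set ε := ν / 2 - (2 + α + 3 * α ^ 2) * C / δ with hε
  have hε0 : 0 < ε := by linarith
  set b₁ := (3 * α ^ 2 + α) * C / δ with hb₁
  set b₂ := α ^ 2 * C / (2 * δ) with hb₂
  have hb₁0 : 0 ≤ b₁ := by positivity
  have hb₂0 : 0 ≤ b₂ := by positivity
  set t : ℕ → ℝ := fun n => ‖u (n + 1) - u n‖ with htdef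
  have ht0 : ∀ n, 0 ≤ t n := fun n => norm_nonneg _
  set L : ℕ → ℝ := fun n => splitLagrangian A T f G δ (u (n + 2)) (v (n + 2)) (p (n + 2)) with hLdef
  have hEL : ∀ n, E n = L n + (b₁ * t (n + 1) ^ 2 + b₂ * t n ^ 2) := fun n => by
    simp only [hEdef, energy, hLdef, htdef]
    ring
  have hLE : ∀ n, L n ≤ E n := fun n => by
    have : 0 ≤ b₁ * t (n + 1) ^ 2 + b₂ * t n ^ 2 := by positivity
    linarith [hEL n]
  have hdesc : ∀ n, ε * t (n + 2) ^ 2 ≤ E n - E (n + 1) := h.energy_succ_le hα hδ hν hθ0 hθ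
  have hanti : Antitone E := antitone_nat_of_succ_le fun n => by
    have : 0 ≤ ε * t (n + 2) ^ 2 := by positivity
    linarith [hdesc n]
  have hLm : ∀ n, m ≤ L n := fun n => by
    have h1 := sq_add_le_splitLagrangian (G := G) (v := v (n + 2)) hδ hθ0 hθ hδθ
      (h.stationary (n + 2))
    have h2 : 0 ≤ δ / 2 * ‖T (u (n + 2)) - v (n + 2) - (1 / δ) • p (n + 2)‖ ^ 2 := by positivity
    linarith [hm (v (n + 2)), sq_nonneg ‖A (u (n + 2)) - f‖]
  have hbdd : BddBelow (Set.range E) := ⟨m, by rintro _ ⟨n, rfl⟩; exact (hLm n).trans (hLE n)⟩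
  set ℓ := ⨅ n, E n with hℓ
  have hEt : Tendsto E atTop (𝓝 ℓ) := tendsto_atTop_ciInf hanti hbdd
  have hEℓ : ∀ n, ℓ ≤ E n := fun n => ciInf_le hbdd n
  have htt : Tendsto t atTop (𝓝 0) := by
    rw [← tendsto_add_atTop_iff_nat 2]
    have h1 : Tendsto (fun n => (E n - E (n + 1)) / ε) atTop (𝓝 0) := by
      have := (hEt.sub ((tendsto_add_atTop_iff_nat 1).2 hEt)).div_const ε
      simpa using this
    have h2 : Tendsto (fun n => t (n + 2) ^ 2) atTop (𝓝 0) :=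
      squeeze_zero (fun n => by positivity)
        (fun n => by rw [le_div_iff₀ hε0, mul_comm]; exact hdesc n) h1
    have h3 := (Real.continuous_sqrt.tendsto 0).comp h2
    simpa [Function.comp_def, Real.sqrt_sq (ht0 _)] using h3
  have hLt : Tendsto L atTop (𝓝 ℓ) := by
    have h1 := (hEt.sub ((((tendsto_add_atTop_iff_nat 1).2 htt).pow 2).const_mul b₁)).sub
      ((htt.pow 2).const_mul b₂)
    simp only [ne_eq, OfNat.ofNat_ne_zero, not_false_eq_true, zero_pow, mul_zero, sub_zero] at h1
    refine h1.congr fun n => ?_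
    rw [hEL]
    ring
  set z : ℕ → WithLp 2 (U × WithLp 2 (V × V)) := fun n =>
    WithLp.toLp 2 (u (n + 2), WithLp.toLp 2 (v (n + 2), p (n + 2))) with hz
  obtain ⟨R, hR⟩ := exists_bound_of_splitLagrangian_le hδ hν0 hν hθ0 hθ hδθ hm hcoer (f := f) (E 0)
  have hzR : ∀ n, ‖z n‖ ≤ R := fun n =>
    hR _ _ _ (h.stationary _) ((hLE n).trans (hanti (Nat.zero_le n)))
  have : ProperSpace (WithLp 2 (U × WithLp 2 (V × V))) := FiniteDimensional.proper_real _
  obtain ⟨η, ρ, d, hd, hev⟩ := exists_isDesingularizer_along_seq (ℓ := ℓ) hzR (fun x hx => by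
    obtain ⟨ψ, hψ, hψx⟩ := hx.tendsto_subseq
    exact h.isCriticalPoint_of_tendsto_subseq hα hδ hθ0 hθ hG htt hLt hψ hψx) hKL
  choose g hg hgn using h.exists_mem_frechetSubdiff hα hδ hθ0 hθ
  set M := (δ * ‖T‖ + δ + 1) * ((α + 1) * (θ * ‖A‖ ^ 2)) + δ * ‖T‖ with hM
  have hM0 : 0 ≤ M := by positivity
  set M' := √(2 * (b₁ + b₂)) with hM'
  have hEη : ∀ᶠ n in atTop, E n < ℓ + η := hEt.eventually (gt_mem_nhds (by linarith [hd.pos]))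
  have hsum : Summable t := by
    refine summable_of_desingularized_descent (M := M + M')
      ((hd.comp_half).add (IsDesingularizer.sqrt hd.pos)) hε0 (by positivity) ht0 hEℓ hdesc hEη ?_
    filter_upwards [hev, hEη] with n hn hEn hlt
    set e := E n - ℓ with he
    have he0 : 0 < e := by linarith
    have hτ : 0 ≤ t (n + 1) + t n := add_nonneg (ht0 _) (ht0 _)
    have hd0 : 0 ≤ d (e / 2) := hd.slope_nonneg _ ⟨by linarith, by linarith⟩
    have hs0 : 0 < √e := Real.sqrt_pos.2 he0
    have expand : (d (e / 2) + (√e)⁻¹) * ((M + M') * (t (n + 1) + t n))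
        = d (e / 2) * (M * (t (n + 1) + t n)) + (√e)⁻¹ * (M' * (t (n + 1) + t n))
          + d (e / 2) * (M' * (t (n + 1) + t n)) + (√e)⁻¹ * (M * (t (n + 1) + t n)) := by ring
    rw [expand]
    have p1 : 0 ≤ d (e / 2) * (M * (t (n + 1) + t n)) := by positivity
    have p2 : 0 ≤ (√e)⁻¹ * (M' * (t (n + 1) + t n)) := by positivity
    have p3 : 0 ≤ d (e / 2) * (M' * (t (n + 1) + t n)) := by positivity
    have p4 : 0 ≤ (√e)⁻¹ * (M * (t (n + 1) + t n)) := by positivity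
    rcases lt_or_ge (e / 2) (L n - ℓ) with hcase | hcase
    · have h1 : 1 ≤ d (L n - ℓ) * ‖g n‖ :=
        hn (show ℓ < L n by linarith) (show L n < ℓ + η by linarith [hLE n]) (g n) (hg n)
      have h2 : d (L n - ℓ) ≤ d (e / 2) :=
        hd.antitone (by linarith) hcase.le (by linarith [hLE n])
      have h3 : d (L n - ℓ) * ‖g n‖ ≤ d (e / 2) * (M * (t (n + 1) + t n)) :=
        mul_le_mul h2 (hgn n) (norm_nonneg _) hd0
      linarith
    · have h1 : e ≤ 2 * (b₁ + b₂) * (t (n + 1) + t n) ^ 2 := by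
        have h2 := hEL n
        have h3 : t (n + 1) ^ 2 ≤ (t (n + 1) + t n) ^ 2 :=
          pow_le_pow_left₀ (ht0 _) (by linarith [ht0 n]) 2
        have h4 : t n ^ 2 ≤ (t (n + 1) + t n) ^ 2 :=
          pow_le_pow_left₀ (ht0 _) (by linarith [ht0 (n + 1)]) 2
        have h5 := mul_le_mul_of_nonneg_left h3 hb₁0
        have h6 := mul_le_mul_of_nonneg_left h4 hb₂0
        linarith
      have h2 : √e ≤ M' * (t (n + 1) + t n) := by
        have := Real.sqrt_le_sqrt h1
        rwa [Real.sqrt_mul (by positivity), Real.sqrt_sq hτ] at this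
      have h3 : 1 ≤ (√e)⁻¹ * (M' * (t (n + 1) + t n)) := by
        rw [inv_mul_eq_div, le_div_iff₀ hs0]
        linarith
      linarith
  obtain ⟨x, y, q, hx, hy, hq⟩ := h.exists_tendsto_of_summable hα hδ hθ0 hθ hsum
  have hlim : Tendsto (fun n => WithLp.toLp 2 (u n, WithLp.toLp 2 (v n, p n))) atTop
      (𝓝 (WithLp.toLp 2 (x, WithLp.toLp 2 (y, q)))) :=
    ((WithLp.prod_continuous_toLp 2 _ _).tendsto _).comp (hx.prodMk_nhds
      (((WithLp.prod_continuous_toLp 2 _ _).tendsto _).comp (hy.prodMk_nhds hq)))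
  refine ⟨x, y, q, hlim, ?_⟩
  exact (h.isCriticalPoint_of_tendsto_subseq hα hδ hθ0 hθ hG htt hLt strictMono_id
    ((tendsto_add_atTop_iff_nat 2).2 hlim)).2

end IsInertialADMM

end Convergence

/-! ### The discrete Wirtinger inequality -/

theorem sq_sub_ge_of_pos {a b x y : ℝ} (ha : 0 < a) (hb : 0 < b) :
    (1 - a / b) * y ^ 2 + (1 - b / a) * x ^ 2 ≤ (y - x) ^ 2 := by
  have h : (y - x) ^ 2 - ((1 - a / b) * y ^ 2 + (1 - b / a) * x ^ 2)
      = (a * y - b * x) ^ 2 / (a * b) := by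
    field_simp
    ring
  have : 0 ≤ (a * y - b * x) ^ 2 / (a * b) := by positivity
  linarith

theorem discrete_wirtinger {N : ℕ} (hN : 1 ≤ N) {x : ℕ → ℝ} (h0 : x 0 = 0) (hxN : x N = 0) :
    4 * Real.sin (Real.pi / (2 * N)) ^ 2 * ∑ j ∈ Finset.range N, x j ^ 2
      ≤ ∑ j ∈ Finset.range N, (x (j + 1) - x j) ^ 2 := by
  have hN' : (0 : ℝ) < N := by exact_mod_cast hN
  set s : ℕ → ℝ := fun j => Real.sin (j * (Real.pi / N)) with hs
  have hpos : ∀ j, 0 < j → j < N → 0 < s j := fun j h1 h2 => by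
    have h1' : (0 : ℝ) < j := by exact_mod_cast h1
    have h2' : (j : ℝ) < N := by exact_mod_cast h2
    refine Real.sin_pos_of_pos_of_lt_pi (by positivity) ?_
    rw [← mul_div_assoc, div_lt_iff₀ hN', mul_comm]
    exact mul_lt_mul_of_pos_left h2' Real.pi_pos
  have hs0 : s 0 = 0 := by simp [hs]
  have hsN : s N = 0 := by simp [hs, mul_div_cancel₀ _ hN'.ne']
  have hrec : ∀ j, s (j + 2) + s j = 2 * Real.cos (Real.pi / N) * s (j + 1) := fun j => by
    simp only [hs]
    push_cast
    rw [show ((j : ℝ) + 2) * (Real.pi / N) = ((j : ℝ) + 1) * (Real.pi / N) + Real.pi / N by ring,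
      show (j : ℝ) * (Real.pi / N) = ((j : ℝ) + 1) * (Real.pi / N) - Real.pi / N by ring,
      Real.sin_add, Real.sin_sub]
    ring
  have hcos : 2 - 2 * Real.cos (Real.pi / N) = 4 * Real.sin (Real.pi / (2 * N)) ^ 2 := by
    rw [show Real.pi / N = 2 * (Real.pi / (2 * N)) by field_simp, Real.cos_two_mul, Real.cos_sq']
    ring
  have hstep : ∀ j ∈ Finset.range N, (1 - s j / s (j + 1)) * x (j + 1) ^ 2
      + (1 - s (j + 1) / s j) * x j ^ 2 ≤ (x (j + 1) - x j) ^ 2 := by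
    intro j hj
    rw [Finset.mem_range] at hj
    rcases Nat.eq_zero_or_pos j with rfl | hj0
    · simp [h0, hs0]
    · rcases (show j + 1 ≤ N from hj).eq_or_lt with hjN | hjN
      · simp [hjN, hxN, hsN]
      · exact sq_sub_ge_of_pos (hpos j hj0 hj) (hpos (j + 1) (by omega) hjN)
  refine le_trans (le_of_eq ?_) (Finset.sum_le_sum hstep)
  obtain ⟨n, rfl⟩ : ∃ n, N = n + 1 := ⟨N - 1, by omega⟩
  have e1 : ∑ j ∈ Finset.range (n + 1), x j ^ 2 = ∑ j ∈ Finset.range n, x (j + 1) ^ 2 := by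
    rw [Finset.sum_range_succ', h0]
    simp
  have e2 : ∑ j ∈ Finset.range (n + 1), (1 - s j / s (j + 1)) * x (j + 1) ^ 2
      = ∑ j ∈ Finset.range n, (1 - s j / s (j + 1)) * x (j + 1) ^ 2 := by
    rw [Finset.sum_range_succ, hxN]
    simp
  have e3 : ∑ j ∈ Finset.range (n + 1), (1 - s (j + 1) / s j) * x j ^ 2
      = ∑ j ∈ Finset.range n, (1 - s (j + 2) / s (j + 1)) * x (j + 1) ^ 2 := by
    rw [Finset.sum_range_succ', h0]
    simp
  rw [Finset.sum_add_distrib, e1, e2, e3, ← Finset.sum_add_distrib, Finset.mul_sum]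
  refine Finset.sum_congr rfl fun j hj => ?_
  have hj' := Finset.mem_range.1 hj
  have hsj := hpos (j + 1) (by omega) (by omega)
  rw [← hcos, eq_sub_of_add_eq (hrec j)]
  field_simp
  ring

/-! ### Matrices acting on Euclidean spaces -/

section Matrix

variable {m n k : Type*} [Fintype m] [Fintype n] [Fintype k] [DecidableEq n]

theorem toEuclideanLin_transpose [DecidableEq m] (M : Matrix m n ℝ) (y : EuclideanSpace ℝ m) :
    Matrix.toEuclideanLin M.transpose y
      = (Matrix.toEuclideanLin M).toContinuousLinearMap.adjoint y := by
  rw [← LinearMap.adjoint_toContinuousLinearMap, ← Matrix.toEuclideanLin_conjTranspose_eq_adjoint,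
    Matrix.conjTranspose_eq_transpose_of_trivial]
  rfl

theorem toEuclideanLin_mul {l : Type*} [DecidableEq k] (M : Matrix l n ℝ)
    (M' : Matrix n k ℝ) (x : EuclideanSpace ℝ k) :
    Matrix.toEuclideanLin (M * M') x = Matrix.toEuclideanLin M (Matrix.toEuclideanLin M' x) := by
  simp [Matrix.toLpLin_apply, Matrix.mulVec_mulVec]

theorem inner_toEuclideanLin_gram [DecidableEq m] (M : Matrix m n ℝ) (x y : EuclideanSpace ℝ n) :
    ⟪Matrix.toEuclideanLin (M.transpose * M) x, y⟫
      = ⟪Matrix.toEuclideanLin M x, Matrix.toEuclideanLin M y⟫ := by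
  rw [toEuclideanLin_mul, toEuclideanLin_transpose, ContinuousLinearMap.adjoint_inner_left]
  rfl

theorem lambdaMin_isLeast [Nonempty n] {S : Matrix n n ℝ}
    (hsymm : (Matrix.toEuclideanLin S).IsSymmetric)
    (hpsd : ∀ x, 0 ≤ ⟪Matrix.toEuclideanLin S x, x⟫) :
    Module.End.HasEigenvalue (Matrix.toEuclideanLin S : Module.End ℝ (EuclideanSpace ℝ n))
        (lambdaMin S) ∧
      ∀ x, lambdaMin S * ‖x‖ ^ 2 ≤ ⟪Matrix.toEuclideanLin S x, x⟫ := by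
  set R : {x : EuclideanSpace ℝ n // x ≠ 0} → ℝ := fun x =>
    ⟪Matrix.toEuclideanLin S x, x⟫ / ‖(x : EuclideanSpace ℝ n)‖ ^ 2 with hR
  have hev := hsymm.hasEigenvalue_iInf_of_finiteDimensional
  change Module.End.HasEigenvalue _ (⨅ x, R x) at hev
  have hbdd : BddBelow (Set.range R) :=
    ⟨0, by rintro _ ⟨x, rfl⟩; exact div_nonneg (hpsd _) (by positivity)⟩
  have hmin : lambdaMin S = ⨅ x, R x := by
    refine IsLeast.csInf_eq ⟨hev, fun μ hμ => ?_⟩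
    obtain ⟨x, hx⟩ := Module.End.HasEigenvalue.exists_hasEigenvector hμ
    refine (ciInf_le hbdd ⟨x, hx.2⟩).trans (le_of_eq ?_)
    have : ‖x‖ ≠ 0 := norm_ne_zero_iff.2 hx.2
    simp only [hR]
    rw [hx.apply_eq_smul, real_inner_smul_left, real_inner_self_eq_norm_sq]
    field_simp
  rw [hmin]
  refine ⟨hev, fun x => ?_⟩
  rcases eq_or_ne x 0 with rfl | hx
  · simp
  · have hx' : 0 < ‖x‖ ^ 2 := by positivity
    rw [← le_div_iff₀ hx']
    exact ciInf_le hbdd ⟨x, hx⟩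

theorem inner_toEuclideanLin_gram_add [DecidableEq m] [DecidableEq k] (M : Matrix m n ℝ)
    (M' : Matrix k n ℝ) (δ : ℝ)
    (x y : EuclideanSpace ℝ n) :
    ⟪Matrix.toEuclideanLin (M.transpose * M + δ • (M'.transpose * M')) x, y⟫
      = ⟪Matrix.toEuclideanLin M x, Matrix.toEuclideanLin M y⟫
        + δ * ⟪Matrix.toEuclideanLin M' x, Matrix.toEuclideanLin M' y⟫ := by
  rw [map_add, map_smul, LinearMap.add_apply, LinearMap.smul_apply, inner_add_left,
    real_inner_smul_left, inner_toEuclideanLin_gram, inner_toEuclideanLin_gram]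

theorem lambdaMin_gram_add [DecidableEq m] [DecidableEq k] [Nonempty n] (M : Matrix m n ℝ)
    (M' : Matrix k n ℝ)
    (hker : ∀ x, Matrix.toEuclideanLin M x = 0 → Matrix.toEuclideanLin M' x = 0 → x = 0) :
    0 < lambdaMin (M.transpose * M + M'.transpose * M') ∧
      ∀ x, lambdaMin (M.transpose * M + M'.transpose * M') * ‖x‖ ^ 2
        ≤ ‖Matrix.toEuclideanLin M x‖ ^ 2 + ‖Matrix.toEuclideanLin M' x‖ ^ 2 := by
  have hin := inner_toEuclideanLin_gram_add M M' 1
  simp only [one_smul, one_mul] at hin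
  have hself : ∀ x, ⟪Matrix.toEuclideanLin (M.transpose * M + M'.transpose * M') x, x⟫
      = ‖Matrix.toEuclideanLin M x‖ ^ 2 + ‖Matrix.toEuclideanLin M' x‖ ^ 2 := fun x => by
    rw [hin, real_inner_self_eq_norm_sq, real_inner_self_eq_norm_sq]
  obtain ⟨hev, hle⟩ := lambdaMin_isLeast (S := M.transpose * M + M'.transpose * M')
    (fun x y => by
      rw [← real_inner_comm x, hin, hin, real_inner_comm (Matrix.toEuclideanLin M x),
        real_inner_comm (Matrix.toEuclideanLin M' x)])
    (fun x => by rw [hself]; positivity)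
  refine ⟨?_, fun x => (hle x).trans_eq (hself x)⟩
  obtain ⟨x, hx⟩ := hev.exists_hasEigenvector
  have h1 := hself x
  rw [hx.apply_eq_smul, real_inner_smul_left, real_inner_self_eq_norm_sq] at h1
  have hx0 : 0 < ‖x‖ ^ 2 := by have := norm_pos_iff.2 hx.2; positivity
  have h2 : 0 < ‖Matrix.toEuclideanLin M x‖ ^ 2 + ‖Matrix.toEuclideanLin M' x‖ ^ 2 := by
    by_contra! hle
    refine hx.2 (hker x ?_ ?_)
    · rw [← norm_eq_zero, ← sq_eq_zero_iff]
      nlinarith [sq_nonneg ‖Matrix.toEuclideanLin M x‖, sq_nonneg ‖Matrix.toEuclideanLin M' x‖]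
    · rw [← norm_eq_zero, ← sq_eq_zero_iff]
      nlinarith [sq_nonneg ‖Matrix.toEuclideanLin M x‖, sq_nonneg ‖Matrix.toEuclideanLin M' x‖]
  rw [← h1] at h2
  exact (mul_pos_iff_of_pos_right hx0).1 h2

theorem toEuclideanLin_inv_apply {S : Matrix n n ℝ}
    (hS : ∀ x, Matrix.toEuclideanLin S x = 0 → x = 0) (b : EuclideanSpace ℝ n) :
    Matrix.toEuclideanLin S (Matrix.toEuclideanLin S⁻¹ b) = b := by
  have hunit : IsUnit S := by
    rw [← Matrix.mulVec_injective_iff_isUnit]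
    intro x y hxy
    have := hS (WithLp.toLp 2 (x - y)) (by
      rw [Matrix.toLpLin_toLp]
      rw [Matrix.toLin'_apply, Matrix.mulVec_sub, sub_eq_zero.2 hxy]
      rfl)
    have := congrArg WithLp.ofLp this
    simpa [sub_eq_zero] using this
  rw [← toEuclideanLin_mul, Matrix.mul_nonsing_inv _ ((Matrix.isUnit_iff_isUnit_det _).1 hunit)]
  simp

end Matrix

/-! ### The discrete gradient and the blur operator -/

section Deblurring

variable {N : ℕ}

theorem diffMatrix_transpose_lower_bound (hN : 1 ≤ N) (y : Fin (N - 1) → ℝ) :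
    4 * Real.sin (Real.pi / (2 * N)) ^ 2 * ∑ i, y i ^ 2
      ≤ ∑ r, (∑ i, diffMatrix N i r * y i) ^ 2 := by
  set x : ℕ → ℝ := fun j => ∑ i : Fin (N - 1), if j = (i : ℕ) + 1 then y i else 0 with hx
  have hD : ∀ r : Fin N, ∑ i, diffMatrix N i r * y i = x (r + 1) - x r := fun r => by
    simp only [hx]
    rw [← Finset.sum_sub_distrib]
    refine Finset.sum_congr rfl fun i _ => ?_
    simp only [diffMatrix, add_left_inj]
    split_ifs with h1 h2
    · omega
    all_goals simp
  have h0 : x 0 = 0 := by simp [hx]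
  have hxN : x N = 0 := Finset.sum_eq_zero fun i _ => if_neg (by omega)
  have hsum : ∑ j ∈ Finset.range N, x j ^ 2 = ∑ i, y i ^ 2 := by
    obtain ⟨n, rfl⟩ : ∃ n, N = n + 1 := ⟨N - 1, by omega⟩
    rw [Finset.sum_range_succ', h0, Finset.sum_range]
    simp only [ne_eq, OfNat.ofNat_ne_zero, not_false_eq_true, zero_pow, add_zero]
    refine Finset.sum_congr rfl fun i _ => ?_
    congr 1
    simp only [hx, add_left_inj]
    exact (Finset.sum_eq_single (show Fin (n + 1 - 1) from i)
      (fun j _ hj => if_neg fun h => hj (Fin.ext h.symm)) (by simp)).trans (if_pos rfl)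
  have := discrete_wirtinger hN h0 hxN
  rw [hsum, Finset.sum_range] at this
  simpa only [hD] using this

theorem gradMatrix_transpose_mulVec_inl (q : Edge N → ℝ) (c r : Fin N) :
    (gradMatrix N).transpose.mulVec q (Sum.inl (c, r))
      = ∑ i, diffMatrix N i r * q (Sum.inl (c, i)) := by
  simp only [gradMatrix, Matrix.mulVec, dotProduct, Matrix.transpose_apply, Fintype.sum_sum_type,
    Matrix.fromBlocks_apply₁₁, Matrix.fromBlocks_apply₂₁, Matrix.zero_apply, zero_mul,
    Finset.sum_const_zero, add_zero, Matrix.kroneckerMap_apply, Fintype.sum_prod_type,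
    Matrix.one_apply]
  rw [Finset.sum_eq_single c (fun c' _ h => by simp [h]) (by simp)]
  simp

theorem gradMatrix_transpose_mulVec_inr (q : Edge N → ℝ) (c r : Fin N) :
    (gradMatrix N).transpose.mulVec q (Sum.inr (c, r))
      = ∑ i, diffMatrix N i c * q (Sum.inr (i, r)) := by
  simp only [gradMatrix, Matrix.mulVec, dotProduct, Matrix.transpose_apply, Fintype.sum_sum_type,
    Matrix.fromBlocks_apply₁₂, Matrix.fromBlocks_apply₂₂, Matrix.zero_apply, zero_mul,
    Finset.sum_const_zero, zero_add, Matrix.kroneckerMap_apply, Fintype.sum_prod_type,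
    Matrix.one_apply]
  refine Finset.sum_congr rfl fun i _ => ?_
  rw [Finset.sum_eq_single r (fun r' _ h => by simp [h]) (by simp)]
  simp

theorem sin_pi_div_two_mul_pos (hN : 1 ≤ N) : 0 < Real.sin (Real.pi / (2 * N)) := by
  have hN' : (1 : ℝ) ≤ N := by exact_mod_cast hN
  refine Real.sin_pos_of_pos_of_lt_pi (by positivity) ?_
  rw [div_lt_iff₀ (by positivity)]
  nlinarith [Real.pi_pos]

theorem thetaConst_pos (hN : 1 ≤ N) : 0 < thetaConst N := by
  have := sin_pi_div_two_mul_pos hN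
  unfold thetaConst
  positivity

theorem norm_le_thetaConst_mul (hN : 1 ≤ N) (q : VSpace N) :
    ‖q‖ ≤ thetaConst N * ‖Matrix.toEuclideanLin (gradMatrix N).transpose q‖ := by
  have hs := sin_pi_div_two_mul_pos hN
  have key : 4 * Real.sin (Real.pi / (2 * N)) ^ 2 * ‖q‖ ^ 2
      ≤ ‖Matrix.toEuclideanLin (gradMatrix N).transpose q‖ ^ 2 := by
    rw [EuclideanSpace.real_norm_sq_eq, EuclideanSpace.real_norm_sq_eq, Fintype.sum_sum_type,
      Fintype.sum_sum_type, mul_add]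
    refine add_le_add ?_ ?_
    · rw [Fintype.sum_prod_type, Fintype.sum_prod_type, Finset.mul_sum]
      refine Finset.sum_le_sum fun c _ => ?_
      refine (diffMatrix_transpose_lower_bound hN fun i => q (Sum.inl (c, i))).trans (le_of_eq ?_)
      exact Finset.sum_congr rfl fun r _ => by
        rw [← gradMatrix_transpose_mulVec_inl (fun e => q e)]; rfl
    · rw [Fintype.sum_prod_type_right, Fintype.sum_prod_type_right, Finset.mul_sum]
      refine Finset.sum_le_sum fun r _ => ?_
      refine (diffMatrix_transpose_lower_bound hN fun i => q (Sum.inr (i, r))).trans (le_of_eq ?_)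
      exact Finset.sum_congr rfl fun c _ => by
        rw [← gradMatrix_transpose_mulVec_inr (fun e => q e)]; rfl
  rw [thetaConst, one_div, inv_mul_eq_div, le_div_iff₀ (by positivity)]
  refine abs_le_of_sq_le_sq' ?_ (norm_nonneg _) |>.2
  linarith

theorem gradMatrix_mulVec_one (hN : 1 ≤ N) : (gradMatrix N).mulVec (fun _ => 1) = 0 := by
  have hD : ∀ i : Fin (N - 1), ∑ j, diffMatrix N i j = 0 := fun i => by
    have e : ∀ j : Fin N, diffMatrix N i j
        = (if j = ⟨i, by omega⟩ then 1 else 0) + (if j = ⟨i + 1, by omega⟩ then -1 else 0) :=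
      fun j => by
        simp only [diffMatrix, Fin.ext_iff]
        split_ifs with h1 h2
        · omega
        all_goals simp
    simp only [e, Finset.sum_add_distrib, Finset.sum_ite_eq', Finset.mem_univ, if_true]
    norm_num
  funext e
  rcases e with ⟨c, i⟩ | ⟨i, r⟩
  · simp only [gradMatrix, Matrix.mulVec, dotProduct, Fintype.sum_sum_type,
      Matrix.fromBlocks_apply₁₁, Matrix.fromBlocks_apply₁₂, Matrix.zero_apply,
      Finset.sum_const_zero, add_zero, Matrix.kroneckerMap_apply, Fintype.sum_prod_type, mul_one,
      Pi.zero_apply]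
    refine Finset.sum_eq_zero fun x _ => ?_
    exact (Finset.mul_sum Finset.univ (diffMatrix N i) ((1 : Matrix _ _ ℝ) c x)).symm.trans
      (by rw [hD, mul_zero])
  · simp only [gradMatrix, Matrix.mulVec, dotProduct, Fintype.sum_sum_type,
      Matrix.fromBlocks_apply₂₁, Matrix.fromBlocks_apply₂₂, Matrix.zero_apply,
      Finset.sum_const_zero, zero_add, Matrix.kroneckerMap_apply, Fintype.sum_prod_type_right,
      mul_one, Pi.zero_apply]
    refine Finset.sum_eq_zero fun x _ => ?_
    exact (Finset.sum_mul Finset.univ (diffMatrix N i) ((1 : Matrix _ _ ℝ) r x)).symm.trans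
      (by rw [hD, zero_mul])

theorem blurMatrix_one_eq_zero_of_eq_zero {Kt : Matrix (Pix N) (Pix N) ℝ} {β : ℝ} (hβ : β ≠ 0)
    {x : USpace N} (hx : Matrix.toEuclideanLin (blurMatrix Kt β) x = 0) :
    Matrix.toEuclideanLin (blurMatrix Kt 1) x = 0 := by
  have h : (blurMatrix Kt β).mulVec x.ofLp = 0 := congrArg WithLp.ofLp hx
  suffices (blurMatrix Kt 1).mulVec x.ofLp = 0 from congrArg (WithLp.toLp 2) this
  rw [blurMatrix, Matrix.fromBlocks_mulVec] at h ⊢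
  have h1 := fun i => congrFun h (Sum.inl i)
  have h2 := fun i => congrFun h (Sum.inr i)
  funext i
  rcases i with i | i
  · simpa using h1 i
  · have := h2 i
    simp only [Sum.elim_inr, Matrix.smul_mulVec, Matrix.neg_mulVec, Matrix.one_mulVec,
      Pi.add_apply, Pi.neg_apply, Pi.smul_apply, smul_eq_mul, Pi.zero_apply, Function.comp_apply,
      one_mul] at this ⊢
    have h3 : β * (x.ofLp (Sum.inl i) + -x.ofLp (Sum.inr i)) = 0 := by linarith
    exact (mul_eq_zero.1 h3).resolve_left hβ

/-! ### The regularizer -/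

theorem phiNorm_const (φ : ℝ → ℝ) (t : ℝ) :
    phiNorm φ (WithLp.toLp 2 (fun _ : Edge N => t)) = Fintype.card (Edge N) * φ t := by
  simp [phiNorm]

theorem exists_lower_bound_of_coercive {φ : ℝ → ℝ}
    (hφ : Filter.Tendsto φ (Filter.cocompact ℝ) Filter.atTop) (hlsc : LowerSemicontinuous φ) :
    ∃ m, ∀ t, m ≤ φ t := by
  obtain ⟨S, hS, hSφ⟩ := Filter.mem_cocompact.1 (hφ.eventually (Filter.eventually_ge_atTop 0))
  rcases S.eq_empty_or_nonempty with rfl | hne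
  · exact ⟨0, fun t => hSφ (by simp)⟩
  · obtain ⟨t₀, -, ht₀⟩ := (hlsc.lowerSemicontinuousOn S).exists_isMinOn hne hS
    refine ⟨min 0 (φ t₀), fun t => ?_⟩
    by_cases ht : t ∈ S
    · exact (min_le_right _ _).trans (ht₀ ht)
    · exact (min_le_left _ _).trans (hSφ ht)

theorem lowerSemicontinuous_of_phiNorm [Nonempty (Edge N)] {φ : ℝ → ℝ} {σ : ℝ} (hσ : 0 < σ)
    (h : LowerSemicontinuous fun v : VSpace N => σ * phiNorm φ v) : LowerSemicontinuous φ := by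
  have hc : 0 < σ * Fintype.card (Edge N) := by
    have : (0 : ℝ) < Fintype.card (Edge N) := by exact_mod_cast Fintype.card_pos
    positivity
  have hcont : Continuous fun t : ℝ => (WithLp.toLp 2 (fun _ : Edge N => t) : VSpace N) :=
    (PiLp.continuous_toLp 2 _).comp (continuous_pi fun _ => continuous_id)
  intro t y hy
  have h1 := h (WithLp.toLp 2 fun _ => t) (σ * Fintype.card (Edge N) * y) (by
    change _ < σ * phiNorm φ _
    rw [phiNorm_const, ← mul_assoc]
    exact mul_lt_mul_of_pos_left hy hc)
  filter_upwards [hcont.continuousAt.eventually h1] with s hs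
  rw [phiNorm_const, ← mul_assoc] at hs
  exact lt_of_mul_lt_mul_left hs hc.le

theorem exists_lower_bound_phiNorm {φ : ℝ → ℝ} {σ : ℝ} (hσ : 0 < σ)
    (hφ : Filter.Tendsto φ (Filter.cocompact ℝ) Filter.atTop)
    (h : LowerSemicontinuous fun v : VSpace N => σ * phiNorm φ v) :
    (∃ m, ∀ v : VSpace N, m ≤ σ * phiNorm φ v) ∧
      ∀ c, Bornology.IsBounded {v : VSpace N | σ * phiNorm φ v ≤ c} := by
  rcases isEmpty_or_nonempty (Edge N) with he | he
  · have : Subsingleton (VSpace N) := ⟨fun x y => by ext e; exact he.elim e⟩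
    exact ⟨⟨0, fun v => by simp [phiNorm]⟩, fun c => (Set.toFinite _).isBounded⟩
  · obtain ⟨m₀, hm₀⟩ := exists_lower_bound_of_coercive hφ (lowerSemicontinuous_of_phiNorm hσ h)
    set m := min 0 m₀ with hmdef
    have hm : ∀ t, m ≤ φ t := fun t => (min_le_right _ _).trans (hm₀ t)
    have hm0 : m ≤ 0 := min_le_left _ _
    refine ⟨⟨σ * (Fintype.card (Edge N) * m), fun v => ?_⟩, fun c => ?_⟩
    · refine mul_le_mul_of_nonneg_left ?_ hσ.le
      rw [← nsmul_eq_mul, ← Finset.card_univ]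
      exact Finset.card_nsmul_le_sum _ _ _ fun e _ => hm _
    · set b := c / σ - Fintype.card (Edge N) * m with hb
      obtain ⟨S, hS, hSφ⟩ := Filter.mem_cocompact.1 (hφ.eventually (Filter.eventually_gt_atTop b))
      obtain ⟨r, hr⟩ := hS.isBounded.exists_norm_le
      rw [isBounded_iff_forall_norm_le]
      refine ⟨√(Fintype.card (Edge N) * r ^ 2), fun v hv => Real.le_sqrt_of_sq_le ?_⟩
      rw [EuclideanSpace.real_norm_sq_eq, ← nsmul_eq_mul, ← Finset.card_univ]
      refine Finset.sum_le_card_nsmul _ _ _ fun e _ => ?_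
      have hv' : phiNorm φ v ≤ c / σ := by
        rw [le_div_iff₀ hσ, mul_comm]
        exact hv
      have he : φ (v e) ≤ b := by
        have h1 : ∑ e' ∈ Finset.univ.erase e, (φ (v e') - m) + (φ (v e) - m)
            = phiNorm φ v - Fintype.card (Edge N) * m := by
          rw [Finset.sum_erase_add _ _ (Finset.mem_univ e), Finset.sum_sub_distrib]
          simp [phiNorm]
        have h2 : 0 ≤ ∑ e' ∈ Finset.univ.erase e, (φ (v e') - m) :=
          Finset.sum_nonneg fun e' _ => sub_nonneg.2 (hm _)
        linarith
      have hmem : v e ∈ S := by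
        by_contra hn
        have : b < φ (v e) := hSφ hn
        linarith
      rw [← sq_abs]
      exact pow_le_pow_left₀ (abs_nonneg _) (hr _ hmem) 2

end Deblurring

section Assembly

variable {N : ℕ} {Kt : Matrix (Pix N) (Pix N) ℝ} {ft : EuclideanSpace ℝ (Pix N)}
  {φ : ℝ → ℝ} {β σ α δ : ℝ}

theorem lowerSemicontinuous_phiNorm_of_auxFun
    (h : LowerSemicontinuous (auxFun Kt ft β σ δ α φ)) :
    LowerSemicontinuous fun v : VSpace N => σ * phiNorm φ v := by
  have hc : Continuous fun v : VSpace N =>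
      (WithLp.toLp 2 (triple 0 v 0, (0 : USpace N)) : WSpace N) := by
    have h1 : Continuous fun v : VSpace N =>
        (WithLp.toLp 2 (v, (0 : VSpace N)) : WithLp 2 (VSpace N × VSpace N)) :=
      (WithLp.prod_continuous_toLp 2 _ _).comp (continuous_id.prodMk continuous_const)
    have h2 : Continuous fun v : VSpace N => triple (0 : USpace N) v 0 :=
      (WithLp.prod_continuous_toLp 2 _ _).comp (continuous_const.prodMk h1)
    exact (WithLp.prod_continuous_toLp 2 _ _).comp (h2.prodMk continuous_const)
  have hcont : Continuous fun v : VSpace N =>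
      -(1 / 2 * ‖dataVec ft‖ ^ 2 + δ / 2 * ‖v‖ ^ 2) := by fun_prop
  have hsum := (h.comp hc).add hcont.lowerSemicontinuous
  have e : (fun v : VSpace N => σ * phiNorm φ v) = fun v =>
      (auxFun Kt ft β σ δ α φ ∘ fun v : VSpace N =>
        (WithLp.toLp 2 (triple 0 v 0, (0 : USpace N)) : WSpace N)) v
        + -(1 / 2 * ‖dataVec ft‖ ^ 2 + δ / 2 * ‖v‖ ^ 2) := by
    funext v
    simp [auxFun, augLagrangian, triple]
  rw [e]
  exact hsum

theorem toEuclideanLin_blur_grad_eq_zero (hβ : β ≠ 0)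
    (hnull : LinearMap.ker (Matrix.toEuclideanLin (blurMatrix Kt 1)) ⊓
      LinearMap.ker (Matrix.toEuclideanLin (gradMatrix N)) = ⊥) (x : USpace N)
    (h1 : Matrix.toEuclideanLin (blurMatrix Kt β) x = 0)
    (h2 : Matrix.toEuclideanLin (gradMatrix N) x = 0) : x = 0 := by
  rw [← Submodule.mem_bot ℝ, ← hnull]
  exact ⟨blurMatrix_one_eq_zero_of_eq_zero hβ h1, h2⟩

theorem IsIADMM.isInertialADMM (hδ : 0 < δ)
    (hker : ∀ x : USpace N, Matrix.toEuclideanLin (blurMatrix Kt β) x = 0 →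
      Matrix.toEuclideanLin (gradMatrix N) x = 0 → x = 0)
    {u : ℕ → USpace N} {v p : ℕ → VSpace N} (hseq : IsIADMM Kt ft β σ δ α φ u v p) :
    IsInertialADMM (Matrix.toEuclideanLin (blurMatrix Kt β)).toContinuousLinearMap
      (Matrix.toEuclideanLin (gradMatrix N)).toContinuousLinearMap (dataVec ft)
      (fun v => σ * phiNorm φ v) δ α (fun n => u (n + 2)) (fun n => v (n + 2))
      (fun n => p (n + 2)) where
  stationary n := by
    have hinj : ∀ x, Matrix.toEuclideanLin ((blurMatrix Kt β).transpose * blurMatrix Kt β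
        + δ • ((gradMatrix N).transpose * gradMatrix N)) x = 0 → x = 0 := fun x hx => by
      have h := inner_toEuclideanLin_gram_add (blurMatrix Kt β) (gradMatrix N) δ x x
      rw [hx, inner_zero_left, real_inner_self_eq_norm_sq, real_inner_self_eq_norm_sq] at h
      have h1 := sq_nonneg ‖Matrix.toEuclideanLin (blurMatrix Kt β) x‖
      have h2 := mul_nonneg hδ.le (sq_nonneg ‖Matrix.toEuclideanLin (gradMatrix N) x‖)
      refine hker x ?_ ?_
      · rw [← norm_eq_zero, ← sq_eq_zero_iff]
        linarith
      · have h3 : δ * ‖Matrix.toEuclideanLin (gradMatrix N) x‖ ^ 2 = 0 := by linarith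
        simpa [hδ.ne'] using h3
    have h := congrArg (Matrix.toEuclideanLin ((blurMatrix Kt β).transpose * blurMatrix Kt β
        + δ • ((gradMatrix N).transpose * gradMatrix N))) (hseq.step_u n)
    rw [toEuclideanLin_inv_apply hinj, map_add, map_smul, LinearMap.add_apply,
      LinearMap.smul_apply, toEuclideanLin_mul, toEuclideanLin_mul] at h
    simp only [toEuclideanLin_transpose] at h
    simp only [hseq.step_p n, map_sub, map_smul, LinearMap.coe_toContinuousLinearMap'] at h ⊢
    rw [smul_sub, sub_eq_iff_eq_add, eq_sub_of_add_eq h]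
    abel
  dual n := by
    have h := hseq.step_p (n + 2)
    change δ • (Matrix.toEuclideanLin (gradMatrix N) (u (n + 2 + 2)) - v (n + 2 + 2))
      = extrap α p (n + 2) - p (n + 2 + 2)
    rw [h, sub_sub_cancel]
  prox n y := by
    have h := hseq.step_v (n + 2) y
    change σ * phiNorm φ (v (n + 2 + 2)) + δ / 2 * ‖Matrix.toEuclideanLin (gradMatrix N)
      (u (n + 2 + 1)) - (1 / δ) • extrap α p (n + 2) - v (n + 2 + 2)‖ ^ 2 ≤ σ * phiNorm φ y
      + δ / 2 * ‖Matrix.toEuclideanLin (gradMatrix N) (u (n + 2 + 1))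
        - (1 / δ) • extrap α p (n + 2) - y‖ ^ 2
    have h' := mul_le_mul_of_nonneg_left h hδ.le
    simp only [mul_add, ← mul_assoc, mul_div_cancel₀ σ hδ.ne'] at h'
    linarith

theorem nuConst_le_specNorm_sq (hN : 1 ≤ N)
    (hν : ∀ x : USpace N, nuConst Kt β * ‖x‖ ^ 2 ≤
      ‖Matrix.toEuclideanLin (blurMatrix Kt β) x‖ ^ 2
        + ‖Matrix.toEuclideanLin (gradMatrix N) x‖ ^ 2) :
    nuConst Kt β ≤ specNorm (blurMatrix Kt β) ^ 2 := by
  set x : USpace N := WithLp.toLp 2 fun _ => 1 with hx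
  have hx0 : x ≠ 0 := fun h => one_ne_zero (congrFun (congrArg WithLp.ofLp h)
    (Sum.inl (⟨0, hN⟩, ⟨0, hN⟩)) : (1 : ℝ) = 0)
  have hT : Matrix.toEuclideanLin (gradMatrix N) x = 0 :=
    congrArg (WithLp.toLp 2) (gradMatrix_mulVec_one hN)
  have h := hν x
  have hK : ‖Matrix.toEuclideanLin (blurMatrix Kt β) x‖ ≤ specNorm (blurMatrix Kt β) * ‖x‖ :=
    (Matrix.toEuclideanLin (blurMatrix Kt β)).toContinuousLinearMap.le_opNorm x
  have hK2 := pow_le_pow_left₀ (norm_nonneg _) hK 2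
  rw [hT, norm_zero] at h
  have : 0 < ‖x‖ ^ 2 := by have := norm_pos_iff.2 hx0; positivity
  refine le_of_mul_le_mul_right ?_ this
  linarith

end Assembly

end

theorem theorem2 (N : ℕ) (hN : 1 ≤ N)
    (Kt : Matrix (Pix N) (Pix N) ℝ) (ft : EuclideanSpace ℝ (Pix N))
    (φ : ℝ → ℝ) (β σ α δ : ℝ) (hβ : 0 < β) (hσ : 0 < σ) (hα : 0 < α)
    (hφ : Filter.Tendsto φ (Filter.cocompact ℝ) Filter.atTop)
    (hnull : LinearMap.ker (Matrix.toEuclideanLin (blurMatrix Kt 1)) ⊓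
      LinearMap.ker (Matrix.toEuclideanLin (gradMatrix N)) = ⊥)
    (hδ : max 1 (max
        (6 * thetaConst N ^ 2 * specNorm (blurMatrix Kt β) ^ 4 / nuConst Kt β
          + 7 * α ^ 2 * thetaConst N ^ 2 * specNorm (blurMatrix Kt β) ^ 4 / nuConst Kt β)
        (thetaConst N ^ 2 * specNorm (blurMatrix Kt β) ^ 4)) < δ)
    (hKL : IsKLFunction (auxFun Kt ft β σ δ α φ))
    (u : ℕ → USpace N) (v p : ℕ → VSpace N)
    (hseq : IsIADMM Kt ft β σ δ α φ u v p) :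
    ∃ (uStar : USpace N) (vStar pStar : VSpace N),
      Filter.Tendsto (fun k => triple (u k) (v k) (p k)) Filter.atTop
        (nhds (triple uStar vStar pStar)) ∧
      IsCriticalPoint (augLagrangian Kt ft β σ δ φ) (triple uStar vStar pStar) := by
  have hker := toEuclideanLin_blur_grad_eq_zero hβ.ne' hnull
  have : Nonempty (Pix N ⊕ Pix N) := ⟨Sum.inl (⟨0, hN⟩, ⟨0, hN⟩)⟩
  obtain ⟨hν0, hν⟩ := lambdaMin_gram_add (blurMatrix Kt β) (gradMatrix N) hker
  change 0 < nuConst Kt β at hν0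
  have hδ1 : 1 < δ := (le_max_left _ _).trans_lt hδ
  have hδ2 := ((le_max_left _ _).trans (le_max_right _ _)).trans_lt hδ
  have hνκ := nuConst_le_specNorm_sq hN hν
  set κ := specNorm (blurMatrix Kt β) with hκ
  set θ := thetaConst N with hθdef
  have hadmm := hseq.isInertialADMM (by linarith) hker
  have hlsc := lowerSemicontinuous_phiNorm_of_auxFun hKL.1
  obtain ⟨⟨m, hm⟩, hcoer⟩ := exists_lower_bound_phiNorm hσ hφ hlsc
  have hC : 0 ≤ θ ^ 2 * κ ^ 4 := by positivity
  have hδ3 : 6 * (θ ^ 2 * κ ^ 4) + 7 * α ^ 2 * (θ ^ 2 * κ ^ 4) < nuConst Kt β * δ := by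
    rw [← add_div, div_lt_iff₀ hν0] at hδ2
    linarith
  have hδθ : 2 * (θ ^ 2 * κ ^ 2) ≤ δ := by
    have h1 : θ ^ 2 * κ ^ 2 * nuConst Kt β ≤ θ ^ 2 * κ ^ 4 := by
      calc θ ^ 2 * κ ^ 2 * nuConst Kt β ≤ θ ^ 2 * κ ^ 2 * κ ^ 2 :=
            mul_le_mul_of_nonneg_left hνκ (by positivity)
        _ = θ ^ 2 * κ ^ 4 := by ring
    have h2 : 0 ≤ 7 * α ^ 2 * (θ ^ 2 * κ ^ 4) := by positivity
    refine le_of_mul_le_mul_right ?_ hν0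
    linarith
  have hδν : (2 + α + 3 * α ^ 2) * (θ ^ 2 * κ ^ 4) / δ < nuConst Kt β / 2 := by
    rw [div_lt_iff₀ (by linarith)]
    have : 0 ≤ (1 + (1 - α) ^ 2) * (θ ^ 2 * κ ^ 4) := by positivity
    linarith
  obtain ⟨x, y, q, hlim, hcrit⟩ := hadmm.exists_tendsto_isCriticalPoint hα.le hδ1.le hν0 hν
    (thetaConst_pos hN).le
    (fun q => by rw [← toEuclideanLin_transpose]; exact norm_le_thetaConst_mul hN q)
    hδθ hδν hlsc hm hcoer fun z hz =>
      hKL.exists_isDesingularizer (J := augLagrangian Kt ft β σ δ φ) (π := WithLp.fst)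
        (c := 7 * α ^ 2 * θ ^ 2 * κ ^ 4 / (2 * δ)) (by positivity)
        (WithLp.continuous_fst 2 _ _) (fun _ => rfl) hz
  exact ⟨x, y, q, (Filter.tendsto_add_atTop_iff_nat 2).1 hlim, hcrit⟩
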